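/- Throughout, $\mathcal H$ is a finite-dimensional complex Hilbert space and $\mathcal D(\mathcal H)$ the set of its density matrices. A *source* over $\mathcal H$ is a sequence $(\rho_n)_n$ with $\rho_n\in\mathcal D(\mathcal H^{\otimes n})$; it is a source of pure states if every $\rho_n$ is a rank-one projection. For $I\subseteq[n]=\{1,\dots,n\}$ write $(\rho_n)_I=\operatorname{Tr}_{I^c}\rho_n$. For $\rho_n,\sigma_n\in\mathcal D(\mathcal H^{\otimes n})$ let $$\|\rho_n-\sigma_n\|_{W_1}=\inf\Big\{\sum_{i=1}^n c_i:\ c_i\ge 0,\ \rho_n-\sigma_n=\sum_{i=1}^n c_i(\tau^{(i)}-\eta^{(i)}),\ \tau^{(i)},\eta^{(i)}\in\mathcal D(\mathcal H^{\otimes n}),\ \operatorname{Tr}_{\{i\}}\tau^{(i)}=\operatorname{Tr}_{\{i\}}\eta^{(i)}\Big\}.$$ Let $\rho\in\mathcal D(\mathcal H)$. The source $(\rho_n)_n$ is *Wasserstein almost i.i.d. along $\rho$* if $\lim_{n\to\infty}\frac1n\|\rho_n-\rho^{\otimes n}\|_{W_1}=0$. It is *weakly almost i.i.d. along $\rho$*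 if for every fixed integer $k\ge1$ $$\lim_{n\to\infty}\binom nk^{-1}\sum_{I\subseteq[n],\,|I|=k}\big\|(\rho_n)_I-\rho^{\otimes I}\big\|_1=0,$$ where $\|A\|_1=\operatorname{Tr}\sqrt{A^\dagger A}$. A source $(\Psi_n)_n$ of pure states of qubits ($\mathcal H=\mathbb C^2$) is *highly uniform* if for all sufficiently large $n$ the reduced state $(\Psi_n)_I$ is maximally mixed for every $I\subseteq[n]$ with $|I|\le 0.189\,n$. Then: 1. If $\dim\mathcal H\ge2$, no source of pure states over $\mathcal H$ is Wasserstein almost i.i.d. along the maximally mixed state $\mathbf 1/\dim\mathcal H$. 2. Highly uniform sources of pure qubit states exist. Every such source is weakly almost i.i.d. along the maximally mixed state $\mathbf 1/2$, but is not Wasserstein almost i.i.d. along it. 3. For every $\mathcal H$ and every $\rho\in\mathcal D(\mathcal H)$, every source that is Wasserstein almost i.i.d. along $\rho$ is weakly almost i.i.d. along $\rho$. For $\mathcal H=\mathbb C^2$ this inclusion is strict: the set of Wasserstein almost i.i.d. sources along $\mathbf 1/2$ is a proper subset of the set of weakly almost i.i.d. sources along $\mathbf 1/2$, and the set of sources that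 are Wasserstein almost i.i.d. along some state is a proper subset of the set of sources that are weakly almost i.i.d. along some state. -/

import Mathlib

open Filter Topology
open scoped NNReal ENNReal Matrix ComplexOrder

namespace AlmostIID

/-- The density matrices of a quantum system whose finite-dimensional Hilbert space has an
orthonormal basis indexed by `ι`: the positive semidefinite complex matrices of unit trace.
With `ι = (Fin n → d)` this is the set of states of the `n`-fold tensor power of the Hilbert
space `ℂ^d`, written in the product basis. -/
structure DensityMatrix (ι : Type*) [Fintype ι] where
  val : Matrix ι ι ℂ
  posSemidef : val.PosSemidef
  trace_eq_one : val.trace = 1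

/-- A state is pure if it is the rank-one projection onto a unit vector. -/
def DensityMatrix.IsPure {ι : Type*} [Fintype ι] (ρ : DensityMatrix ι) : Prop :=
  ∃ ψ : ι → ℂ, (∑ x, ‖ψ x‖ ^ 2 = 1) ∧ ρ.val = Matrix.vecMulVec ψ (star ψ)

/-- The maximally mixed state, the identity divided by the dimension. -/
noncomputable def maximallyMixed (ι : Type*) [Fintype ι] [DecidableEq ι] [Nonempty ι] :
    DensityMatrix ι :=
  ⟨((Fintype.card ι : ℂ)⁻¹) • (1 : Matrix ι ι ℂ),
    Matrix.PosSemidef.smul Matrix.PosSemidef.one (inv_nonneg.mpr (Nat.cast_nonneg _)), by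
      have h : (Fintype.card ι : ℂ) ≠ 0 := Nat.cast_ne_zero.mpr Fintype.card_ne_zero
      simp [Matrix.trace_smul, Matrix.trace_one, h]⟩

/-- The matrix, in the product basis, of the tensor product over `j : J` of copies of the
operator with matrix `A`. -/
def tensorPowerMatrix {d : Type*} (J : Type*) [Fintype J] (A : Matrix d d ℂ) :
    Matrix (J → d) (J → d) ℂ :=
  Matrix.of fun x y => ∏ j, A (x j) (y j)

theorem tensorPowerMatrix_mul {d J : Type*} [Fintype d] [Fintype J] [DecidableEq J]
    (A B : Matrix d d ℂ) :
    tensorPowerMatrix J (A * B) = tensorPowerMatrix J A * tensorPowerMatrix J B := by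
  ext x y
  simp only [tensorPowerMatrix, Matrix.of_apply, Matrix.mul_apply, ← Finset.prod_mul_distrib]
  rw [Finset.prod_univ_sum, Fintype.piFinset_univ]

theorem tensorPowerMatrix_conjTranspose {d J : Type*} [Fintype J] (A : Matrix d d ℂ) :
    (tensorPowerMatrix J A)ᴴ = tensorPowerMatrix J Aᴴ := by
  ext x y
  simp [tensorPowerMatrix, Matrix.conjTranspose_apply]

theorem tensorPowerMatrix_trace {d J : Type*} [Fintype d] [Fintype J] [DecidableEq J]
    (A : Matrix d d ℂ) : (tensorPowerMatrix J A).trace = ∏ _j : J, A.trace := by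
  simp only [tensorPowerMatrix, Matrix.trace, Matrix.diag_apply, Matrix.of_apply]
  rw [Finset.prod_univ_sum, Fintype.piFinset_univ]

open scoped MatrixOrder Matrix.Norms.L2Operator in
theorem exists_eq_conjTranspose_mul_self {d : Type*} [Fintype d] {A : Matrix d d ℂ}
    (hA : A.PosSemidef) : ∃ B : Matrix d d ℂ, A = Bᴴ * B := by
  classical
  exact CStarAlgebra.nonneg_iff_eq_star_mul_self.mp hA.nonneg

/-- The i.i.d. state `ρ^{⊗ J}`: one copy of `ρ` for each `j : J`. -/
def tensorPower {d : Type*} [Fintype d] (J : Type*) [Fintype J] [DecidableEq J]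
    (ρ : DensityMatrix d) : DensityMatrix (J → d) :=
  ⟨tensorPowerMatrix J ρ.val, by
    obtain ⟨B, hB⟩ := exists_eq_conjTranspose_mul_self ρ.posSemidef
    rw [hB, tensorPowerMatrix_mul, ← tensorPowerMatrix_conjTranspose]
    exact Matrix.posSemidef_conjTranspose_mul_self _, by
    rw [tensorPowerMatrix_trace, ρ.trace_eq_one]
    simp⟩

/-- The string over `[n]` that equals `x` on `I` and `z` on the complement of `I`. -/
def glue {d : Type*} {n : ℕ} (I : Finset (Fin n)) (x : {j // j ∈ I} → d)
    (z : {j // j ∉ I} → d) : Fin n → d :=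
  fun j => if h : j ∈ I then x ⟨j, h⟩ else z ⟨j, h⟩

/-- The reduced operator `Tr_{Iᶜ} A` on the subsystems in `I`. -/
def marginal {d : Type*} [Fintype d] {n : ℕ} (I : Finset (Fin n))
    (A : Matrix (Fin n → d) (Fin n → d) ℂ) :
    Matrix ({j // j ∈ I} → d) ({j // j ∈ I} → d) ℂ :=
  Matrix.of fun x y => ∑ z : {j // j ∉ I} → d, A (glue I x z) (glue I y z)

/-- The operator `Tr_{A_i} A` obtained by discarding the `i`-th subsystem. -/
def traceOut {d : Type*} [Fintype d] {n : ℕ} (i : Fin n)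
    (A : Matrix (Fin n → d) (Fin n → d) ℂ) :
    Matrix ({j // j ∈ ({i}ᶜ : Finset (Fin n))} → d)
      ({j // j ∈ ({i}ᶜ : Finset (Fin n))} → d) ℂ :=
  marginal {i}ᶜ A

/-- The trace norm `‖A‖₁ = Tr √(A† A)`. -/
noncomputable def traceNorm {ι : Type*} [Fintype ι] [DecidableEq ι] (A : Matrix ι ι ℂ) : ℝ :=
  (Matrix.trace (cfc Real.sqrt (Aᴴ * A))).re

/-- The quantum Wasserstein distance of order one, `‖ρ - σ‖_{W₁}`: the least `∑ i, c i` over all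
decompositions `ρ - σ = ∑ i, c i (τ i - η i)` with `c i ≥ 0` and `τ i`, `η i` states that
coincide after the `i`-th subsystem is discarded. The infimum is taken in `[0, ∞]`. -/
noncomputable def wassersteinDist {d : Type*} [Fintype d] {n : ℕ}
    (ρ σ : DensityMatrix (Fin n → d)) : ℝ≥0∞ :=
  sInf {w : ℝ≥0∞ | ∃ (c : Fin n → ℝ≥0) (τ η : Fin n → DensityMatrix (Fin n → d)),
    (∀ i, traceOut i (τ i).val = traceOut i (η i).val) ∧
    ρ.val - σ.val = ∑ i, ((c i : ℝ) : ℂ) • ((τ i).val - (η i).val) ∧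
    w = ((∑ i, c i : ℝ≥0) : ℝ≥0∞)}

/-- A source over the single-system Hilbert space `ℂ^d`: for every `n`, a state of `n` systems. -/
abbrev Source (d : Type*) [Fintype d] : Type _ := (n : ℕ) → DensityMatrix (Fin n → d)

/-- `(ρ_n)` is a Wasserstein almost i.i.d. source along `ρ`:
`(1/n) ‖ρ_n - ρ^{⊗ n}‖_{W₁} → 0`. -/
def IsWassersteinAlmostIID {d : Type*} [Fintype d] (ρn : Source d) (ρ : DensityMatrix d) : Prop :=
  Tendsto (fun n : ℕ => wassersteinDist (ρn n) (tensorPower (Fin n) ρ) / (n : ℝ≥0∞)) atTop (𝓝 0)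

/-- `(ρ_n)` is a weakly almost i.i.d. source along `ρ`: for every fixed `k ≥ 1`, the average over
all `I ⊆ [n]` with `|I| = k` of `‖(ρ_n)_I - ρ^{⊗ I}‖₁` tends to zero. -/
def IsWeaklyAlmostIID {d : Type*} [Fintype d] [DecidableEq d]
    (ρn : Source d) (ρ : DensityMatrix d) : Prop :=
  ∀ k : ℕ, 1 ≤ k → Tendsto (fun n : ℕ =>
    ((n.choose k : ℝ))⁻¹ * ∑ I ∈ Finset.powersetCard k (Finset.univ : Finset (Fin n)),
      traceNorm (marginal I (ρn n).val - (tensorPower {j // j ∈ I} ρ).val)) atTop (𝓝 0)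

/-- A source of highly uniform pure qubit states: each `Ψ_n` is pure and, for all large enough
`n`, every reduced state of `Ψ_n` on at most `0.189 n` qubits is maximally mixed. -/
def IsHighlyUniform (Ψ : Source (Fin 2)) : Prop :=
  (∀ n, (Ψ n).IsPure) ∧
  ∀ᶠ n : ℕ in atTop, ∀ I : Finset (Fin n), (I.card : ℝ) ≤ 0.189 * n →
    marginal I (Ψ n).val = (maximallyMixed ({j // j ∈ I} → Fin 2)).val

end AlmostIID

namespace AlmostIID

/-! ### Trace inequalities, the trace norm and the Hilbert–Schmidt norm. -/

section TraceNorm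

/-! Wasserstein implies weak: in a decomposition `∑ i, c i (τ i - η i)`, the marginal on `I` kills
every term with `i ∉ I`, so its trace norm is at most `2 ∑ i ∈ I, c i`. A site lies in a fraction `k
/ n` of the `k`-subsets, so the average over them is at most `2 k / n` times the cost of the
decomposition (`isWeaklyAlmostIID_of_isWassersteinAlmostIID`).

Pure sources stay far from the maximally mixed state: let `P k` project onto the span of the vectors
reached from `ψ` by acting on at most `k` sites. The observable `H = ∑ k < m, (1 - P k)` acts as a
truncated Hamming distance from `ψ`. It annihilates `ψ`, yet for `m` a small fraction of `n` each of
these spans fills at most half of the space, so the maximally mixed state gives `H` expectation at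
least `m / 2`. Moreover `H` is 1-Lipschitz: up to an operator commuting with the algebra of site
`i`, it lies between `0` and `1`. Pairing `H` with a decomposition bounds its cost below by `m / 2`,
which is linear in `n` (`half_le_wassersteinDist`).

Highly uniform states exist as graph states with amplitudes `± 2 ^ (-n / 2)`, the sign being a
quadratic form over the field with two elements. The marginal on `I` is maximally mixed if the
associated symmetric matrix sends no nonzero vector supported on `I` to a vector supported on `I`. A
Gilbert–Varshamov count finds a matrix good for all small `I` at once. Such a source separates the
two notions. It also separates the unions over all states, because its one-site marginals determine
the state along which it is weakly almost i.i.d. -/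

theorem trace_mul_nonneg {ι : Type*} [Fintype ι] {A B : Matrix ι ι ℂ} (hA : A.PosSemidef) (hB : B.PosSemidef) :
    0 ≤ (A * B).trace := by
  obtain ⟨C, rfl⟩ := exists_eq_conjTranspose_mul_self hA
  rw [Matrix.mul_assoc, Matrix.trace_mul_comm]
  exact (hB.mul_mul_conjTranspose_same C).trace_nonneg

theorem trace_mul_re_le {ι : Type*} [Fintype ι] {A B P : Matrix ι ι ℂ} (h : (B - A).PosSemidef) (hP : P.PosSemidef) :
    (A * P).trace.re ≤ (B * P).trace.re := by
  have := trace_mul_nonneg h hP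
  rw [Matrix.sub_mul, Matrix.trace_sub] at this
  have := (Complex.le_def.mp this).1
  simpa using this

/-- The principal `2 × 2` minors of a positive semidefinite matrix are nonnegative. -/
theorem PosSemidef.normSq_apply_le {ι : Type*} {M : Matrix ι ι ℂ} (hM : M.PosSemidef) (x y : ι) :
    ‖M x y‖ ^ 2 ≤ (M x x).re * (M y y).re := by
  have h := (hM.submatrix ![x, y]).det_nonneg
  have h0 : ∀ x, (M x x).im = 0 := fun x => by
    have := (Complex.le_def.mp (hM.diag_nonneg (i := x))).2
    simpa using this.symm
  have h1 : M y x = star (M x y) := (hM.isHermitian.apply y x).symm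
  rw [Matrix.det_fin_two] at h
  have := (Complex.le_def.mp h).1
  simp [h1, h0] at this
  rw [← Complex.normSq_eq_norm_sq, Complex.normSq_apply]
  linarith

variable {ι : Type*} [Fintype ι] [DecidableEq ι]

theorem continuousOn_spectrum (A : Matrix ι ι ℂ) (f : ℝ → ℝ) : ContinuousOn f (spectrum ℝ A) :=
  Matrix.finite_real_spectrum.continuousOn f

open scoped MatrixOrder in
theorem posSemidef_cfc {A : Matrix ι ι ℂ} {f : ℝ → ℝ} (hf : ∀ x, 0 ≤ f x) :
    (cfc f A).PosSemidef :=
  Matrix.nonneg_iff_posSemidef.mp (cfc_nonneg fun x _ => hf x)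

/-- The trace norm of a difference of two positive operators is at most the sum of their traces. -/
theorem traceNorm_sub_le {P N : Matrix ι ι ℂ} (hP : P.PosSemidef) (hN : N.PosSemidef) :
    traceNorm (P - N) ≤ P.trace.re + N.trace.re := by
  set A := P - N with hA
  have hAh : A.IsHermitian := hP.isHermitian.sub hN.isHermitian
  have hsa : IsSelfAdjoint A := hAh
  -- The sign function gives `|A| = s(A) A` with `-1 ≤ s(A) ≤ 1`; the value at zero is immaterial.
  set s : ℝ → ℝ := fun x => if 0 ≤ x then 1 else -1 with hs
  have h1 : Aᴴ * A = cfc (fun x : ℝ => x ^ 2) A := by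
    rw [hAh.eq, cfc_pow_id (R := ℝ) A 2, pow_two]
  have h2 : cfc Real.sqrt (Aᴴ * A) = cfc s A * A := by
    rw [h1, ← cfc_comp' Real.sqrt (fun x : ℝ => x ^ 2) A
      ((Matrix.finite_real_spectrum.image _).continuousOn _) (continuousOn_spectrum _ _)]
    conv_rhs => enter [2]; rw [← cfc_id ℝ A]
    rw [← cfc_mul s id A (continuousOn_spectrum _ _) (continuousOn_spectrum _ _)]
    congr 1
    ext x
    simp only [hs, Real.sqrt_sq_eq_abs, id]
    split_ifs with h
    · simp [abs_of_nonneg h]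
    · simp [abs_of_neg (not_le.mp h)]
  have h3 : (1 - cfc s A).PosSemidef := by
    rw [← cfc_one ℝ A, ← cfc_sub _ _ A (continuousOn_spectrum _ _) (continuousOn_spectrum _ _)]
    refine posSemidef_cfc fun x => ?_
    simp only [hs]
    split_ifs <;> norm_num
  have h4 : (1 + cfc s A).PosSemidef := by
    rw [← cfc_one ℝ A, ← cfc_add A _ _ (continuousOn_spectrum _ _) (continuousOn_spectrum _ _)]
    refine posSemidef_cfc fun x => ?_
    simp only [hs]
    split_ifs <;> norm_num
  have h5 := trace_mul_re_le h3 hP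
  have h6 := trace_mul_re_le (A := -cfc s A) (B := 1) (by simpa using h4) hN
  rw [traceNorm, h2, hA, Matrix.mul_sub, Matrix.trace_sub, Complex.sub_re]
  simp only [Matrix.neg_mul, Matrix.trace_neg, Complex.neg_re, one_mul] at h5 h6
  linarith

@[simp] theorem traceNorm_zero : traceNorm (0 : Matrix ι ι ℂ) = 0 := by
  have : cfc Real.sqrt (0 : Matrix ι ι ℂ) = 0 := by
    rw [cfc_apply_zero (R := ℝ)]; simp
  simp [traceNorm, this]

theorem traceNorm_nonneg (A : Matrix ι ι ℂ) : 0 ≤ traceNorm A :=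
  (Complex.le_def.mp (posSemidef_cfc Real.sqrt_nonneg).trace_nonneg).1

/-- The Hilbert–Schmidt norm is at most the trace norm. -/
theorem sum_norm_sq_le_traceNorm_sq (A : Matrix ι ι ℂ) :
    ∑ x, ∑ y, ‖A x y‖ ^ 2 ≤ traceNorm A ^ 2 := by
  set M := cfc Real.sqrt (Aᴴ * A) with hM
  have hMp : M.PosSemidef := posSemidef_cfc Real.sqrt_nonneg
  have hAA : (Aᴴ * A).PosSemidef := Matrix.posSemidef_conjTranspose_mul_self A
  have hsa : IsSelfAdjoint (Aᴴ * A) := hAA.isHermitian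
  have h1 : M * M = Aᴴ * A := by
    rw [hM, ← cfc_mul _ _ _ (continuousOn_spectrum _ _) (continuousOn_spectrum _ _)]
    conv_rhs => rw [← cfc_id ℝ (Aᴴ * A)]
    refine cfc_congr fun x hx => ?_
    have : (0 : ℝ) ≤ x := by simpa using (Matrix.posSemidef_iff_isHermitian_and_spectrum_nonneg.mp hAA).2 hx
    simp [Real.mul_self_sqrt this]
  have h2 : ∀ B : Matrix ι ι ℂ, (Bᴴ * B).trace.re = ∑ x, ∑ y, ‖B x y‖ ^ 2 := fun B => by
    rw [Finset.sum_comm]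
    simp only [Matrix.trace, Matrix.diag_apply, Matrix.mul_apply, Matrix.conjTranspose_apply,
      Complex.re_sum]
    refine Finset.sum_congr rfl fun x _ => Finset.sum_congr rfl fun y _ => ?_
    rw [← Complex.normSq_eq_norm_sq, Complex.normSq_apply]
    simp
  -- `A` and `M = |A|` have equal Hilbert–Schmidt norms, and the minor bound for `M` sums to `(Tr M)
  -- ^ 2`.
  calc ∑ x, ∑ y, ‖A x y‖ ^ 2 = ∑ x, ∑ y, ‖M x y‖ ^ 2 := by
        rw [← h2, ← h2, ← h1, hMp.isHermitian.eq]
    _ ≤ ∑ x, ∑ y, (M x x).re * (M y y).re :=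
        Finset.sum_le_sum fun x _ => Finset.sum_le_sum fun y _ => PosSemidef.normSq_apply_le hMp x y
    _ = traceNorm A ^ 2 := by
        rw [← Finset.sum_mul_sum, pow_two]
        simp [traceNorm, ← hM, Matrix.trace, Complex.re_sum]

end TraceNorm

/-! ### Partial traces. -/

section Marginal

variable {d : Type*} [Fintype d] {n : ℕ}

theorem marginal_sub (I : Finset (Fin n)) (A B : Matrix (Fin n → d) (Fin n → d) ℂ) :
    marginal I (A - B) = marginal I A - marginal I B := by
  ext x y
  simp [marginal]

theorem marginal_smul (I : Finset (Fin n)) (c : ℂ) (A : Matrix (Fin n → d) (Fin n → d) ℂ) :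
    marginal I (c • A) = c • marginal I A := by
  ext x y
  simp [marginal, Finset.mul_sum]

theorem marginal_sum {κ : Type*} (s : Finset κ) (I : Finset (Fin n))
    (A : κ → Matrix (Fin n → d) (Fin n → d) ℂ) :
    marginal I (∑ i ∈ s, A i) = ∑ i ∈ s, marginal I (A i) := by
  ext x y
  simp only [marginal, Matrix.of_apply, Matrix.sum_apply]
  exact Finset.sum_comm

theorem PosSemidef.marginal {A : Matrix (Fin n → d) (Fin n → d) ℂ} (hA : A.PosSemidef)
    (I : Finset (Fin n)) : (marginal I A).PosSemidef := by
  have : AlmostIID.marginal I A = ∑ z, A.submatrix (glue I · z) (glue I · z) := by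
    ext x y
    simp [AlmostIID.marginal, Matrix.sum_apply]
  rw [this]
  exact Matrix.posSemidef_sum _ fun z _ => hA.submatrix _

theorem sum_glue {M : Type*} [AddCommMonoid M] (I : Finset (Fin n)) (f : (Fin n → d) → M) :
    ∑ x, ∑ z, f (glue I x z) = ∑ w, f w := by
  rw [← Fintype.sum_prod_type' (f := fun x z => f (glue I x z))]
  exact Fintype.sum_equiv (Equiv.piEquivPiSubtypeProd (· ∈ I) fun _ => d).symm _ _ fun _ => rfl

theorem trace_marginal (I : Finset (Fin n)) (A : Matrix (Fin n → d) (Fin n → d) ℂ) :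
    (marginal I A).trace = A.trace :=
  sum_glue I fun w => A w w

theorem marginal_tensorPower (I : Finset (Fin n)) (ρ : DensityMatrix d) :
    marginal I (tensorPower (Fin n) ρ).val = (tensorPower {j // j ∈ I} ρ).val := by
  ext x y
  have h : ∀ z : {j // j ∉ I} → d, (∏ j, ρ.val (glue I x z j) (glue I y z j)) =
      (∏ j, ρ.val (x j) (y j)) * ∏ j, ρ.val (z j) (z j) := fun z => by
    rw [← Fintype.prod_subtype_mul_prod_subtype (· ∈ I)]
    congr 1
    · exact Finset.prod_congr (by ext; simp) fun j _ => by simp [glue, j.2]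
    · exact Finset.prod_congr (by ext; simp) fun j _ => by simp [glue, j.2]
  simp only [marginal, tensorPower, tensorPowerMatrix, Matrix.of_apply, h]
  rw [← Finset.mul_sum]
  have := tensorPowerMatrix_trace (J := {j // j ∉ I}) ρ.val
  simp only [tensorPowerMatrix, Matrix.trace, Matrix.diag_apply, Matrix.of_apply] at this
  rw [this]
  have h1 := ρ.trace_eq_one
  simp only [Matrix.trace, Matrix.diag_apply] at h1
  simp [h1]

theorem traceOut_eq_zero {i : Fin n} {A : Matrix (Fin n → d) (Fin n → d) ℂ}
    (hA : traceOut i A = 0) (x y : Fin n → d) :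
    ∑ c, A (Function.update x i c) (Function.update y i c) = 0 := by
  have h := congrFun (congrFun hA fun j => x j) fun j => y j
  simp only [traceOut, marginal, Matrix.of_apply, Matrix.zero_apply] at h
  let u : Unique {j // j ∉ ({i}ᶜ : Finset (Fin n))} :=
    ⟨⟨⟨i, by simp⟩⟩, fun j => Subtype.ext (by simpa using j.2)⟩
  rw [← h]
  refine (Fintype.sum_equiv (Equiv.funUnique {j // j ∉ ({i}ᶜ : Finset (Fin n))} d) _ _ ?_).symm
  have key : ∀ (x : Fin n → d) (z : {j // j ∉ ({i}ᶜ : Finset (Fin n))} → d),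
      glue {i}ᶜ (fun j => x j) z = Function.update x i (z default) := fun x z => by
    ext j
    by_cases hj : j = i
    · subst hj
      simp only [glue, Finset.mem_compl, Finset.mem_singleton, not_true_eq_false, dite_false,
        Function.update_self]
      rfl
    · simp [glue, hj]
  intro z
  rw [key, key]
  rfl

/-- Summing over one coordinate first suffices. This serves both partial traces and the character
sums of graph states. -/
theorem sum_eq_zero_of_sum_update {J M : Type*} [Fintype J] [DecidableEq J] [AddCommMonoid M]
    (i : J) (f : (J → d) → M) (hf : ∀ z, ∑ c, f (Function.update z i c) = 0) : ∑ z, f z = 0 := by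
  rw [← (Equiv.funSplitAt i d).symm.sum_comp, Fintype.sum_prod_type_right]
  refine Finset.sum_eq_zero fun w _ => ?_
  rcases isEmpty_or_nonempty d with hd | ⟨⟨c₀⟩⟩
  · simp
  · rw [← hf ((Equiv.funSplitAt i d).symm (c₀, w))]
    refine Finset.sum_congr rfl fun c _ => congrArg f ?_
    ext j
    by_cases hj : j = i
    · subst hj; simp
    · simp [hj]

theorem marginal_eq_zero_of_traceOut {i : Fin n} {A : Matrix (Fin n → d) (Fin n → d) ℂ}
    (hA : traceOut i A = 0) {I : Finset (Fin n)} (hi : i ∉ I) : marginal I A = 0 := by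
  ext x y
  simp only [marginal, Matrix.of_apply, Matrix.zero_apply]
  refine sum_eq_zero_of_sum_update (⟨i, hi⟩ : {j // j ∉ I}) _ fun z => ?_
  have key : ∀ (x : {j // j ∈ I} → d) (c : d),
      glue I x (Function.update z ⟨i, hi⟩ c) = Function.update (glue I x z) i c := fun x c => by
    ext j
    by_cases hj : j = i
    · subst hj; simp [glue, hi]
    · by_cases hjI : j ∈ I <;> simp [glue, hj, hjI]
  simp only [key]
  exact traceOut_eq_zero hA _ _

theorem traceOut_sub_eq_zero {i : Fin n} {A B : Matrix (Fin n → d) (Fin n → d) ℂ}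
    (h : traceOut i A = traceOut i B) : traceOut i (A - B) = 0 := by
  rw [traceOut, marginal_sub]
  exact sub_eq_zero.mpr h

end Marginal

/-! ### Wasserstein almost i.i.d. implies weakly almost i.i.d. -/

section WassersteinToWeak

variable {d : Type*} [Fintype d] [DecidableEq d] {n : ℕ}

/-- Only the terms with `i ∈ I` survive the partial trace; each is a difference of two positive
operators of trace `c i`. -/
theorem traceNorm_marginal_le {A : Matrix (Fin n → d) (Fin n → d) ℂ} {c : Fin n → ℝ≥0}
    {τ η : Fin n → DensityMatrix (Fin n → d)}
    (h : ∀ i, traceOut i (τ i).val = traceOut i (η i).val)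
    (hA : A = ∑ i, ((c i : ℝ) : ℂ) • ((τ i).val - (η i).val)) (I : Finset (Fin n)) :
    traceNorm (marginal I A) ≤ ∑ i ∈ I, 2 * (c i : ℝ) := by
  have hm : marginal I A = ∑ i ∈ I, ((c i : ℝ) : ℂ) • marginal I (τ i).val -
      ∑ i ∈ I, ((c i : ℝ) : ℂ) • marginal I (η i).val := by
    rw [hA, marginal_sum, ← Finset.sum_sub_distrib, ← Finset.sum_subset (Finset.subset_univ I)]
    · refine Finset.sum_congr rfl fun i _ => ?_
      rw [marginal_smul, marginal_sub, smul_sub]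
    · intro i _ hi
      rw [marginal_smul, marginal_eq_zero_of_traceOut (traceOut_sub_eq_zero (h i)) hi, smul_zero]
  have hpos : ∀ σ : Fin n → DensityMatrix (Fin n → d),
      (∑ i ∈ I, ((c i : ℝ) : ℂ) • marginal I (σ i).val).PosSemidef := fun σ =>
    Matrix.posSemidef_sum _ fun i _ => (PosSemidef.marginal (σ i).posSemidef I).smul
      (Complex.zero_le_real.mpr (c i).2)
  have htr : ∀ σ : Fin n → DensityMatrix (Fin n → d),
      (∑ i ∈ I, ((c i : ℝ) : ℂ) • marginal I (σ i).val).trace.re = ∑ i ∈ I, (c i : ℝ) := fun σ => by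
    simp [Matrix.trace_sum, Matrix.trace_smul, trace_marginal, (σ _).trace_eq_one]
  rw [hm]
  refine (traceNorm_sub_le (hpos τ) (hpos η)).trans (le_of_eq ?_)
  rw [htr, htr, ← Finset.mul_sum, two_mul]

theorem card_filter_mem_powersetCard_le {α : Type*} [Fintype α] [DecidableEq α] (k : ℕ) (i : α) :
    (((Finset.univ : Finset α).powersetCard (k + 1)).filter (i ∈ ·)).card ≤
      (Fintype.card α - 1).choose k := by
  have : (((Finset.univ : Finset α).erase i).powersetCard k).card =
      (Fintype.card α - 1).choose k := by
    rw [Finset.card_powersetCard, Finset.card_erase_of_mem (Finset.mem_univ i), Finset.card_univ]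
  rw [← this]
  refine Finset.card_le_card_of_injOn (·.erase i) (fun I hI => ?_) fun I hI J hJ hIJ => ?_
  · simp only [Finset.coe_filter, Finset.mem_powersetCard, Finset.subset_univ, true_and,
      Set.mem_ofPred_eq] at hI
    simp only [Finset.mem_coe, Finset.mem_powersetCard]
    exact ⟨Finset.erase_subset_erase i (Finset.subset_univ I),
      by rw [Finset.card_erase_of_mem hI.2, hI.1]; rfl⟩
  · simp only [Finset.coe_filter, Set.mem_ofPred_eq] at hI hJ
    rw [← Finset.insert_erase hI.2, ← Finset.insert_erase hJ.2]
    exact congrArg (insert i) hIJ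

/-- Double counting: a site lies in `(n - 1).choose k` of the subsets, a fraction `(k + 1) / n` of
them. -/
theorem average_sum_powersetCard_le (k : ℕ) (f : Fin n → ℝ) (hf : ∀ i, 0 ≤ f i) :
    ((n.choose (k + 1) : ℝ))⁻¹ *
      ∑ I ∈ Finset.powersetCard (k + 1) (Finset.univ : Finset (Fin n)), ∑ i ∈ I, f i ≤
      (k + 1) / n * ∑ i, f i := by
  rcases Nat.lt_or_ge n (k + 1) with hn | hn
  · rw [Nat.choose_eq_zero_of_lt hn]
    simp only [Nat.cast_zero, inv_zero, zero_mul]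
    exact mul_nonneg (by positivity) (Finset.sum_nonneg fun i _ => hf i)
  have h1 : ∑ I ∈ Finset.powersetCard (k + 1) (Finset.univ : Finset (Fin n)), ∑ i ∈ I, f i ≤
      ((n - 1).choose k : ℝ) * ∑ i, f i := by
    have : ∀ I : Finset (Fin n), ∑ i ∈ I, f i = ∑ i, if i ∈ I then f i else 0 := fun I => by
      simp
    rw [Finset.sum_congr rfl fun I _ => this I, Finset.sum_comm, Finset.mul_sum]
    refine Finset.sum_le_sum fun i _ => ?_
    rw [← Finset.sum_filter, Finset.sum_const, nsmul_eq_mul]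
    refine mul_le_mul_of_nonneg_right ?_ (hf i)
    have := card_filter_mem_powersetCard_le k i
    rw [Fintype.card_fin] at this
    exact_mod_cast this
  obtain ⟨m, rfl⟩ : ∃ m, n = m + 1 := ⟨n - 1, by omega⟩
  have hc : (0 : ℝ) < ((m + 1).choose (k + 1) : ℕ) := by exact_mod_cast Nat.choose_pos hn
  have h2 : ((m + 1 : ℕ) : ℝ) * (m.choose k : ℕ) = ((m + 1).choose (k + 1) : ℕ) * (k + 1 : ℕ) := by
    exact_mod_cast Nat.add_one_mul_choose_eq m k
  have h3 : (m.choose k : ℝ) = ((m + 1).choose (k + 1) : ℕ) * ((k + 1) / (m + 1 : ℕ)) := by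
    field_simp
    push_cast at h2 ⊢
    linarith
  rw [inv_mul_le_iff₀ hc]
  refine h1.trans (le_of_eq ?_)
  rw [Nat.add_sub_cancel, h3]
  ring

theorem isWeaklyAlmostIID_of_isWassersteinAlmostIID {ρn : Source d} {ρ : DensityMatrix d}
    (h : IsWassersteinAlmostIID ρn ρ) : IsWeaklyAlmostIID ρn ρ := by
  intro k hk
  obtain ⟨k, rfl⟩ : ∃ m, k = m + 1 := ⟨k - 1, by omega⟩
  set a : ℕ → ℝ := fun n => ((n.choose (k + 1) : ℝ))⁻¹ *
    ∑ I ∈ Finset.powersetCard (k + 1) (Finset.univ : Finset (Fin n)),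
      traceNorm (marginal I (ρn n).val - (tensorPower {j // j ∈ I} ρ).val) with ha
  have ha0 : ∀ n, 0 ≤ a n := fun n =>
    mul_nonneg (by positivity) (Finset.sum_nonneg fun I _ => traceNorm_nonneg _)
  have hb : ∀ n, 0 < n → ENNReal.ofReal (a n) ≤
      ENNReal.ofReal (2 * (k + 1)) * (wassersteinDist (ρn n) (tensorPower (Fin n) ρ) / n) := by
    intro n hn
    rw [ENNReal.div_eq_inv_mul, ← mul_assoc]
    have hn' : (n : ℝ≥0∞) ≠ 0 := by exact_mod_cast hn.ne'
    have hC0 : ENNReal.ofReal (2 * (k + 1)) * (n : ℝ≥0∞)⁻¹ ≠ 0 :=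
      mul_ne_zero (by simpa using by positivity) (by simp)
    have hCt : ENNReal.ofReal (2 * (k + 1)) * (n : ℝ≥0∞)⁻¹ ≠ ⊤ :=
      ENNReal.mul_ne_top ENNReal.ofReal_ne_top (by simpa using hn')
    rw [mul_comm, ← ENNReal.div_le_iff hC0 hCt]
    refine le_sInf ?_
    rintro w ⟨c, τ, η, h1, h2, rfl⟩
    rw [ENNReal.div_le_iff hC0 hCt]
    have h3 : a n ≤ (k + 1) / n * ∑ i, 2 * (c i : ℝ) := by
      refine le_trans ?_ (average_sum_powersetCard_le k (fun i => 2 * (c i : ℝ))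
        fun i => by positivity)
      refine mul_le_mul_of_nonneg_left (Finset.sum_le_sum fun I _ => ?_) (by positivity)
      rw [← marginal_tensorPower, ← marginal_sub]
      exact traceNorm_marginal_le h1 h2 I
    refine (ENNReal.ofReal_le_ofReal h3).trans (le_of_eq ?_)
    have h4 : (k + 1) / n * ∑ i, 2 * (c i : ℝ) = (∑ i, c i : ℝ≥0) * ((2 * (k + 1)) * (n : ℝ)⁻¹) := by
      rw [← Finset.mul_sum]
      push_cast
      ring
    rw [h4, ENNReal.ofReal_mul (by positivity), ENNReal.ofReal_mul (by positivity),
      ENNReal.ofReal_inv_of_pos (by exact_mod_cast hn), ENNReal.ofReal_natCast,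
      ENNReal.ofReal_coe_nnreal]
  have hlim : Tendsto (fun n : ℕ => ENNReal.ofReal (2 * (k + 1)) *
      (wassersteinDist (ρn n) (tensorPower (Fin n) ρ) / n)) atTop (𝓝 0) := by
    have := ENNReal.Tendsto.const_mul h (a := ENNReal.ofReal (2 * (k + 1)))
      (Or.inr ENNReal.ofReal_ne_top)
    rwa [mul_zero] at this
  have h0 : Tendsto (fun n => ENNReal.ofReal (a n)) atTop (𝓝 0) :=
    tendsto_of_tendsto_of_tendsto_of_le_of_le' tendsto_const_nhds hlim
      (Eventually.of_forall fun _ => zero_le) ((eventually_gt_atTop 0).mono hb)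
  have := (ENNReal.tendsto_toReal ENNReal.zero_ne_top).comp h0
  simpa [Function.comp_def, ENNReal.toReal_ofReal (ha0 _)] using this

end WassersteinToWeak

/-! ### Orthogonal projections as matrices. -/

section Projection

variable {ι : Type*} [Fintype ι] [DecidableEq ι]

/-- `P` is the matrix of the orthogonal projection onto `K`. -/
structure IsOrthProj (K : Submodule ℂ (ι → ℂ)) (P : Matrix ι ι ℂ) : Prop where
  isHermitian : P.IsHermitian
  mulVec_mem : ∀ v, P *ᵥ v ∈ K
  mulVec_eq : ∀ v ∈ K, P *ᵥ v = v

theorem exists_isOrthProj (K : Submodule ℂ (ι → ℂ)) : ∃ P, IsOrthProj K P := by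
  set e := WithLp.linearEquiv 2 ℂ (ι → ℂ)
  set L : Submodule ℂ (EuclideanSpace ℂ ι) := K.comap e.toLinearMap
  set P := (Matrix.toEuclideanCLM (n := ι) (𝕜 := ℂ)).symm L.starProjection with hP
  have h1 : Matrix.toEuclideanCLM (n := ι) (𝕜 := ℂ) P = L.starProjection := by simp [hP]
  have h2 : ∀ v : ι → ℂ, P *ᵥ v = e (L.starProjection (WithLp.toLp 2 v)) := fun v => by
    rw [← h1]
    rfl
  refine ⟨P, ?_, fun v => ?_, fun v hv => ?_⟩
  · have : IsSelfAdjoint P := by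
      refine (Matrix.toEuclideanCLM (n := ι) (𝕜 := ℂ)).injective ?_
      change Matrix.toEuclideanCLM (n := ι) (𝕜 := ℂ) (star P) =
        Matrix.toEuclideanCLM (n := ι) (𝕜 := ℂ) P
      rw [map_star (Matrix.toEuclideanCLM (n := ι) (𝕜 := ℂ)) P, h1, (isSelfAdjoint_starProjection L).star_eq]
    exact this
  · rw [h2]
    exact L.starProjection_apply_mem (WithLp.toLp 2 v)
  · rw [h2, Submodule.starProjection_eq_self_iff.mpr (show WithLp.toLp 2 v ∈ L from hv)]
    rfl

namespace IsOrthProj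

variable {K L : Submodule ℂ (ι → ℂ)} {P Q : Matrix ι ι ℂ}

theorem mul_eq_of_le (hP : IsOrthProj K P) (hQ : IsOrthProj L Q) (h : K ≤ L) : Q * P = P := by
  refine Matrix.ext_of_mulVec_single fun i => ?_
  rw [← Matrix.mulVec_mulVec]
  exact hQ.mulVec_eq _ (h (hP.mulVec_mem _))

theorem mul_eq_of_le' (hP : IsOrthProj K P) (hQ : IsOrthProj L Q) (h : K ≤ L) : P * Q = P := by
  have := congrArg Matrix.conjTranspose (hP.mul_eq_of_le hQ h)
  rwa [Matrix.conjTranspose_mul, hP.isHermitian.eq, hQ.isHermitian.eq] at this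

theorem posSemidef_sub (hP : IsOrthProj K P) (hQ : IsOrthProj L Q) (h : K ≤ L) :
    (Q - P).PosSemidef := by
  have : Q - P = (Q - P)ᴴ * (Q - P) := by
    rw [(hQ.isHermitian.sub hP.isHermitian).eq, Matrix.sub_mul, Matrix.mul_sub, Matrix.mul_sub,
      hQ.mul_eq_of_le hQ le_rfl, hP.mul_eq_of_le hP le_rfl, hP.mul_eq_of_le hQ h,
      hP.mul_eq_of_le' hQ h]
    simp
  rw [this]
  exact Matrix.posSemidef_conjTranspose_mul_self _

theorem top : IsOrthProj (⊤ : Submodule ℂ (ι → ℂ)) 1 :=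
  ⟨Matrix.isHermitian_one, fun _ => trivial, fun v _ => Matrix.one_mulVec v⟩

theorem bot {ι : Type*} [Fintype ι] : IsOrthProj (⊥ : Submodule ℂ (ι → ℂ)) 0 :=
  ⟨Matrix.isHermitian_zero, fun v => by simp, fun v hv => by
    rw [(Submodule.mem_bot ℂ).mp hv, Matrix.mulVec_zero]⟩

theorem trace_eq (hP : IsOrthProj K P) : P.trace = Module.finrank ℂ K := by
  rw [← LinearMap.IsProj.trace (f := Matrix.toLin' P) (p := K)
    ⟨fun v => by simpa using hP.mulVec_mem v, fun v hv => by simpa using hP.mulVec_eq v hv⟩,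
    Matrix.trace_toLin'_eq]

/-- Invariance of `K` under `E` gives `P E P = E P`; invariance under `Eᴴ` gives, after taking
adjoints, `P E P = P E`. -/
theorem commute (hP : IsOrthProj K P) {E : Matrix ι ι ℂ} (h1 : ∀ v ∈ K, E *ᵥ v ∈ K)
    (h2 : ∀ v ∈ K, Eᴴ *ᵥ v ∈ K) : P * E = E * P := by
  have key : ∀ F : Matrix ι ι ℂ, (∀ v ∈ K, F *ᵥ v ∈ K) → P * (F * P) = F * P := fun F hF => by
    refine Matrix.ext_of_mulVec_single fun i => ?_
    rw [← Matrix.mulVec_mulVec, ← Matrix.mulVec_mulVec]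
    exact hP.mulVec_eq _ (hF _ (hP.mulVec_mem _))
  have h3 := congrArg Matrix.conjTranspose (key _ h2)
  simp only [Matrix.conjTranspose_mul, hP.isHermitian.eq, Matrix.conjTranspose_conjTranspose] at h3
  rw [← h3, Matrix.mul_assoc, key _ h1]

end IsOrthProj

end Projection

/-! ### Matrix units at a single site. -/

section SiteOperators

variable {d : Type*} [Fintype d] [DecidableEq d] {n : ℕ}

/-- The matrix unit `|p⟩⟨q|` acting on the `i`-th subsystem. -/
def siteUnit (i : Fin n) (p q : d) : Matrix (Fin n → d) (Fin n → d) ℂ :=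
  Matrix.of fun x y => if x i = p ∧ y = Function.update x i q then 1 else 0

theorem siteUnit_mulVec (i : Fin n) (p q : d) (v : (Fin n → d) → ℂ) (x : Fin n → d) :
    (siteUnit i p q *ᵥ v) x = if x i = p then v (Function.update x i q) else 0 := by
  simp only [siteUnit, Matrix.mulVec, dotProduct, Matrix.of_apply]
  by_cases h : x i = p <;> simp [h]

theorem siteUnit_mul_apply (i : Fin n) (p q : d) (A : Matrix (Fin n → d) (Fin n → d) ℂ)
    (x y : Fin n → d) :
    (siteUnit i p q * A) x y = if x i = p then A (Function.update x i q) y else 0 :=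
  siteUnit_mulVec i p q (fun z => A z y) x

theorem conjTranspose_siteUnit {d : Type*} [DecidableEq d] (i : Fin n) (p q : d) :
    (siteUnit i p q : Matrix (Fin n → d) (Fin n → d) ℂ)ᴴ = siteUnit i q p := by
  have h : ∀ (p q : d) (x y : Fin n → d), y i = p ∧ x = Function.update y i q →
      x i = q ∧ y = Function.update x i p := by
    rintro p q x y ⟨rfl, rfl⟩
    simp
  ext x y
  simp only [siteUnit, Matrix.conjTranspose_apply, Matrix.of_apply]
  rw [if_congr (⟨h p q x y, h q p y x⟩ : _ ↔ _) rfl rfl]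
  split_ifs <;> simp

theorem mul_siteUnit_apply (i : Fin n) (p q : d) (A : Matrix (Fin n → d) (Fin n → d) ℂ)
    (x y : Fin n → d) :
    (A * siteUnit i p q) x y = if y i = q then A x (Function.update y i p) else 0 := by
  have := siteUnit_mul_apply i q p Aᴴ y x
  rw [← conjTranspose_siteUnit, ← Matrix.conjTranspose_mul, Matrix.conjTranspose_apply] at this
  have := congrArg star this
  rw [star_star] at this
  rw [this]
  split_ifs <;> simp

theorem sum_siteUnit_mul_siteUnit (i : Fin n) (c : d) :
    ∑ p, siteUnit i p c * siteUnit i c p = (1 : Matrix (Fin n → d) (Fin n → d) ℂ) := by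
  ext x y
  simp only [Matrix.sum_apply, siteUnit_mul_apply]
  simp [siteUnit, Matrix.one_apply, eq_comm]

/-- An operator that commutes with all operators on the `i`-th subsystem cannot see operators
that vanish once that subsystem is discarded. -/
theorem trace_mul_eq_zero_of_commute {i : Fin n} {R X : Matrix (Fin n → d) (Fin n → d) ℂ}
    (hR : ∀ p q, R * siteUnit i p q = siteUnit i p q * R) (hX : traceOut i X = 0) :
    (R * X).trace = 0 := by
  rcases isEmpty_or_nonempty d with hd | ⟨⟨c⟩⟩
  · have : IsEmpty (Fin n → d) := ⟨fun x => hd.elim (x i)⟩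
    simp [Matrix.trace]
  -- This sum is `|c⟩⟨c|` at site `i` tensored with the partial trace of `X`.
  have h0 : ∑ p, siteUnit i c p * X * siteUnit i p c = 0 := by
    ext x y
    simp only [Matrix.sum_apply, mul_siteUnit_apply, siteUnit_mul_apply, Matrix.zero_apply]
    by_cases hx : x i = c <;> by_cases hy : y i = c <;> simp [hx, hy, traceOut_eq_zero hX]
  calc (R * X).trace = ((∑ p, siteUnit i p c * siteUnit i c p) * (R * X)).trace := by
        rw [sum_siteUnit_mul_siteUnit, Matrix.one_mul]
    _ = ∑ p, (R * (siteUnit i c p * X * siteUnit i p c)).trace := by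
        rw [Finset.sum_mul, Matrix.trace_sum]
        refine Finset.sum_congr rfl fun p _ => ?_
        rw [Matrix.mul_assoc, Matrix.trace_mul_comm, ← Matrix.mul_assoc (siteUnit i c p), ← hR]
        simp only [Matrix.mul_assoc]
    _ = 0 := by rw [← Matrix.trace_sum, ← Finset.mul_sum, h0, Matrix.mul_zero, Matrix.trace_zero]

end SiteOperators

/-! ### The filtration by the number of sites acted on, and its dimension. -/

section LocalSpan

variable {d : Type*} [DecidableEq d] {n : ℕ}

/-- The vector `(|a⟩⟨b|_I ⊗ 1) ψ`, where only the restrictions of `a` and `b` to `I` matter. -/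
def localGen (ψ : (Fin n → d) → ℂ) (I : Finset (Fin n)) (a b : Fin n → d) : (Fin n → d) → ℂ :=
  fun x => if ∀ j ∈ I, x j = a j then ψ (I.piecewise b x) else 0

/-- The span of the vectors obtained from `ψ` by acting on at most `k` subsystems. -/
def localSpan (ψ : (Fin n → d) → ℂ) (k : ℕ) : Submodule ℂ ((Fin n → d) → ℂ) :=
  Submodule.span ℂ {v | ∃ I a b, I.card ≤ k ∧ v = localGen ψ I a b}

/-- The span of the vectors obtained from `ψ` by acting on at most `k` subsystems and the
`i`-th one. -/
def localSpanInsert (ψ : (Fin n → d) → ℂ) (i : Fin n) (k : ℕ) :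
    Submodule ℂ ((Fin n → d) → ℂ) :=
  Submodule.span ℂ {v | ∃ (I : Finset (Fin n)) (a b : _), I.card ≤ k ∧
    v = localGen ψ (insert i I) a b}

variable (ψ : (Fin n → d) → ℂ)

theorem mem_localSpan (k : ℕ) [Nonempty d] : ψ ∈ localSpan ψ k := by
  obtain ⟨c⟩ := ‹Nonempty d›
  refine Submodule.subset_span ⟨∅, fun _ => c, fun _ => c, by simp, ?_⟩
  ext x
  simp [localGen]

theorem localSpanInsert_le (i : Fin n) (k : ℕ) : localSpanInsert ψ i k ≤ localSpan ψ (k + 1) :=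
  Submodule.span_mono fun _ ⟨I, a, b, hI, hv⟩ =>
    ⟨insert i I, a, b, (Finset.card_insert_le i I).trans (by omega), hv⟩

variable [Fintype d]

/-- Inserts the resolution of the identity `∑ c, |c⟩⟨c|` at site `i`. -/
theorem localGen_eq_sum {i : Fin n} {I : Finset (Fin n)} (hi : i ∉ I) (a b : Fin n → d) :
    localGen ψ I a b =
      ∑ c, localGen ψ (insert i I) (Function.update a i c) (Function.update b i c) := by
  ext x
  have h1 : ∀ c, (∀ j ∈ insert i I, x j = Function.update a i c j) ↔
      (c = x i ∧ ∀ j ∈ I, x j = a j) := fun c => by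
    rw [Finset.forall_mem_insert, Function.update_self, eq_comm]
    refine and_congr_right fun _ => forall₂_congr fun j hj => ?_
    rw [Function.update_of_ne (show j ≠ i from fun h => hi (h ▸ hj))]
  have h2 : (insert i I).piecewise (Function.update b i (x i)) x = I.piecewise b x := by
    ext j
    by_cases hj : j = i
    · subst hj; simp [hi]
    · by_cases hjI : j ∈ I <;> simp [hj, hjI]
  simp only [localGen, Finset.sum_apply, h1]
  by_cases hx : ∀ j ∈ I, x j = a j
  · rw [if_pos hx, Finset.sum_eq_single (x i)]
    · rw [if_pos ⟨rfl, hx⟩, h2]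
    · intro c _ hc
      rw [if_neg fun h => hc h.1]
    · simp
  · rw [if_neg hx]
    exact (Finset.sum_eq_zero fun c _ => if_neg fun h => hx h.2).symm

theorem localSpan_le (i : Fin n) (k : ℕ) : localSpan ψ k ≤ localSpanInsert ψ i k := by
  refine Submodule.span_le.mpr ?_
  rintro _ ⟨I, a, b, hI, rfl⟩
  by_cases hi : i ∈ I
  · exact Submodule.subset_span ⟨I, a, b, hI, by rw [Finset.insert_eq_of_mem hi]⟩
  · rw [localGen_eq_sum ψ hi]
    exact Submodule.sum_mem _ fun c _ => Submodule.subset_span ⟨I, _, _, hI, rfl⟩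

theorem siteUnit_mulVec_localGen {i : Fin n} {J : Finset (Fin n)} (hi : i ∈ J) (p q : d)
    (a b : Fin n → d) : siteUnit i p q *ᵥ localGen ψ J a b =
      if a i = q then localGen ψ J (Function.update a i p) b else 0 := by
  ext x
  have h1 : J.piecewise b (Function.update x i q) = J.piecewise b x := by
    ext j
    by_cases hjJ : j ∈ J
    · simp [hjJ]
    · have : j ≠ i := fun h => hjJ (h ▸ hi)
      simp [hjJ, this]
  have h2 : (x i = p ∧ ∀ j ∈ J, Function.update x i q j = a j) ↔
      (a i = q ∧ ∀ j ∈ J, x j = Function.update a i p j) := by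
    constructor
    · rintro ⟨h, h'⟩
      refine ⟨by simpa using (h' i hi).symm, fun j hj => ?_⟩
      by_cases hji : j = i
      · subst hji; simpa using h
      · simpa [hji] using h' j hj
    · rintro ⟨h, h'⟩
      refine ⟨by simpa using h' i hi, fun j hj => ?_⟩
      by_cases hji : j = i
      · subst hji; simpa using h.symm
      · simpa [hji] using h' j hj
  have h3 : (if a i = q then localGen ψ J (Function.update a i p) b else 0) x =
      if a i = q then localGen ψ J (Function.update a i p) b x else 0 := by
    split_ifs <;> rfl
  rw [siteUnit_mulVec, h3]
  simp only [localGen, h1, ← ite_and]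
  exact if_congr h2 rfl rfl

theorem siteUnit_mulVec_mem (i : Fin n) (k : ℕ) (p q : d) (v : (Fin n → d) → ℂ)
    (hv : v ∈ localSpanInsert ψ i k) : siteUnit i p q *ᵥ v ∈ localSpanInsert ψ i k := by
  have : localSpanInsert ψ i k ≤ (localSpanInsert ψ i k).comap (siteUnit i p q).mulVecLin := by
    refine Submodule.span_le.mpr ?_
    rintro _ ⟨I, a, b, hI, rfl⟩
    simp only [SetLike.mem_coe, Submodule.mem_comap, Matrix.mulVecLin_apply]
    rw [siteUnit_mulVec_localGen ψ (Finset.mem_insert_self i I)]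
    split_ifs
    · exact Submodule.subset_span ⟨I, _, _, hI, rfl⟩
    · exact Submodule.zero_mem _
  exact this hv

theorem finrank_localSpan_le [Nonempty d] (k : ℕ) : Module.finrank ℂ (localSpan ψ k) ≤
    ∑ I : {I : Finset (Fin n) // I.card ≤ k}, (Fintype.card d ^ I.1.card) ^ 2 := by
  obtain ⟨c⟩ := ‹Nonempty d›
  -- The filler `c` outside `I` is arbitrary, since generators read `a` and `b` only on `I`.
  let f : (Σ I : {I : Finset (Fin n) // I.card ≤ k},
      ({j // j ∈ I.1} → d) × ({j // j ∈ I.1} → d)) → (Fin n → d) → ℂ := fun s =>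
    localGen ψ s.1 (glue s.1.1 s.2.1 fun _ => c) (glue s.1.1 s.2.2 fun _ => c)
  have h : localSpan ψ k ≤ Submodule.span ℂ (Set.range f) := by
    refine Submodule.span_mono ?_
    rintro _ ⟨I, a, b, hI, rfl⟩
    refine ⟨⟨⟨I, hI⟩, fun j => a j, fun j => b j⟩, ?_⟩
    ext x
    have h1 : (∀ j ∈ I, x j = glue I (fun j => a j) (fun _ => c) j) ↔ ∀ j ∈ I, x j = a j :=
      forall₂_congr fun j hj => by simp [glue, hj]
    have h2 : I.piecewise (glue I (fun j => b j) fun _ => c) x = I.piecewise b x :=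
      I.piecewise_congr (fun j hj => by simp [glue, hj]) fun _ _ => rfl
    simp only [f, localGen, h1, h2]
  refine (Submodule.finrank_mono h).trans ((finrank_range_le_card f).trans (le_of_eq ?_))
  rw [Fintype.card_sigma]
  refine Finset.sum_congr rfl fun I _ => ?_
  rw [Fintype.card_prod, Fintype.card_fun, Fintype.card_coe, pow_two]

/-- Weighting each `I` by `4 ^ (-|I|)` bounds the dimension by `D ^ (4 k) (5 / 4) ^ n`. The factor
24 comes from sixth powers: `(5 / 4) ^ 6 ≤ 4 ≤ D ^ 2`, so the dimension is at most the square root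
of `D ^ n`. -/
theorem two_mul_finrank_localSpan_le [Nontrivial d] {k : ℕ} (hk : 24 * k ≤ n) (hn : 2 ≤ n) :
    2 * Module.finrank ℂ (localSpan ψ k) ≤ Fintype.card d ^ n := by
  obtain ⟨D, hD⟩ : ∃ D : ℝ, D = Fintype.card d := ⟨_, rfl⟩
  have hD2 : 2 ≤ D := by rw [hD]; exact_mod_cast Fintype.one_lt_card (α := d)
  obtain ⟨r, hr⟩ : ∃ r : ℝ, r = Module.finrank ℂ (localSpan ψ k) := ⟨_, rfl⟩
  have h1 : r ≤ D ^ (4 * k) * (5 / 4) ^ n := by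
    have h := finrank_localSpan_le ψ k
    have h' : r ≤ ∑ I : {I : Finset (Fin n) // I.card ≤ k}, (D ^ I.1.card) ^ 2 := by
      rw [hr, hD]
      exact_mod_cast h
    have h2 : ∀ I : {I : Finset (Fin n) // I.card ≤ k},
        (D ^ I.1.card) ^ 2 ≤ D ^ (4 * k) * (1 / 4) ^ I.1.card := fun I => by
      obtain ⟨I, hI⟩ := I
      have e : D ^ (4 * k) = (D ^ k) ^ 2 * ((D ^ 2) ^ k) := by ring
      have h3 : (D ^ I.card) ^ 2 ≤ (D ^ k) ^ 2 := by
        have : D ^ I.card ≤ D ^ k := pow_le_pow_right₀ (by linarith) hI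
        gcongr
      have h4 : (1 : ℝ) ≤ (D ^ 2) ^ k * (1 / 4) ^ I.card := by
        have h5 : (4 : ℝ) ^ I.card ≤ (D ^ 2) ^ k :=
          (pow_le_pow_right₀ (by norm_num) hI).trans
            (pow_le_pow_left₀ (by norm_num) (by nlinarith) k)
        rw [one_div, inv_pow, ← div_eq_mul_inv, one_le_div (by positivity)]
        exact h5
      rw [e, mul_assoc]
      exact h3.trans (le_mul_of_one_le_right (by positivity) h4)
    refine h'.trans ((Finset.sum_le_sum fun I _ => h2 I).trans ?_)
    rw [← Finset.mul_sum]
    refine mul_le_mul_of_nonneg_left ?_ (by positivity)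
    calc ∑ I : {I : Finset (Fin n) // I.card ≤ k}, (1 / 4 : ℝ) ^ I.1.card
        ≤ ∑ I : Finset (Fin n), (1 / 4 : ℝ) ^ I.card := by
          rw [← Finset.sum_subtype (Finset.univ.filter (·.card ≤ k)) (by simp)
            fun I : Finset (Fin n) => (1 / 4 : ℝ) ^ I.card]
          exact Finset.sum_le_sum_of_subset_of_nonneg (Finset.subset_univ _)
            fun _ _ _ => by positivity
      _ = (5 / 4) ^ n := by
          have := Fin.sum_pow_mul_eq_add_pow (n := n) (1 / 4 : ℝ) 1
          simp only [one_pow, mul_one] at this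
          rw [this]
          norm_num
  have hr0 : 0 ≤ r := hr ▸ Nat.cast_nonneg _
  have h2 : (r ^ 2) ^ 3 ≤ (D ^ n) ^ 3 := by
    calc (r ^ 2) ^ 3 = r ^ 6 := by ring
      _ ≤ (D ^ (4 * k) * (5 / 4) ^ n) ^ 6 := pow_le_pow_left₀ hr0 h1 6
      _ = D ^ (24 * k) * ((5 / 4) ^ 6) ^ n := by
        rw [mul_pow, ← pow_mul, ← pow_mul, ← pow_mul]
        congr 2 <;> ring
      _ ≤ D ^ n * (D ^ 2) ^ n := by
        refine mul_le_mul (pow_le_pow_right₀ (by linarith) hk)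
          (pow_le_pow_left₀ (by norm_num) ?_ n) (by positivity) (by positivity)
        nlinarith
      _ = (D ^ n) ^ 3 := by ring
  have h3 : r ^ 2 ≤ D ^ n := le_of_pow_le_pow_left₀ (by norm_num) (by positivity) h2
  have h4 : 4 ≤ D ^ n := by
    calc (4 : ℝ) = 2 ^ 2 := by norm_num
      _ ≤ D ^ 2 := by gcongr
      _ ≤ D ^ n := pow_le_pow_right₀ (by linarith) hn
  have h5 : 2 * r ≤ D ^ n := by
    refine le_of_sq_le_sq ?_ (by positivity)
    nlinarith
  rw [hr, hD] at h5
  exact_mod_cast h5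

end LocalSpan

/-! ### Lower bound on the Wasserstein distance by a Lipschitz observable. -/

section PureSources

variable {d : Type*} [Fintype d] [DecidableEq d] {n : ℕ}

theorem tensorPower_maximallyMixed [Nonempty d] (J : Type*) [Fintype J] [DecidableEq J] :
    tensorPower J (maximallyMixed d) = maximallyMixed (J → d) := by
  have : (tensorPower J (maximallyMixed d)).val = (maximallyMixed (J → d)).val := by
    ext x y
    simp only [tensorPower, tensorPowerMatrix, maximallyMixed, Matrix.of_apply, Matrix.smul_apply,
      smul_eq_mul, Finset.prod_mul_distrib, Matrix.one_apply, Fintype.prod_ite_zero]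
    simp [funext_iff]
  cases h : tensorPower J (maximallyMixed d)
  cases h' : maximallyMixed (J → d)
  rw [h, h'] at this
  simpa using this

/-- A pure state is at Wasserstein distance at least `m / 2` from the maximally mixed one. -/
theorem half_le_wassersteinDist [Nontrivial d] {ρ : DensityMatrix (Fin n → d)} (hρ : ρ.IsPure)
    {m : ℕ} (hm : 24 * m ≤ n) (hn : 2 ≤ n) :
    ENNReal.ofReal (m / 2) ≤ wassersteinDist ρ (maximallyMixed (Fin n → d)) := by
  obtain ⟨ψ, hψ, hρψ⟩ := hρ
  choose P hP using fun k => exists_isOrthProj (localSpan ψ k)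
  choose R hR using fun i k => exists_isOrthProj (localSpanInsert ψ i k)
  set H := ∑ k ∈ Finset.range m, (1 - P k) with hH
  have hHρ : (H * ρ.val).trace = 0 := by
    have : H * ρ.val = 0 := by
      rw [hH, Finset.sum_mul]
      refine Finset.sum_eq_zero fun k _ => ?_
      rw [hρψ, Matrix.mul_vecMulVec, Matrix.sub_mulVec, Matrix.one_mulVec,
        (hP k).mulVec_eq ψ (mem_localSpan ψ k), sub_self, Matrix.zero_vecMulVec]
    rw [this, Matrix.trace_zero]
  have hHmix : (m / 2 : ℝ) ≤ (H * (maximallyMixed (Fin n → d)).val).trace.re := by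
    have hN : (0 : ℝ) < (Fintype.card d : ℝ) ^ n := by
      have := Fintype.card_pos (α := d)
      positivity
    have h1 : (H * (maximallyMixed (Fin n → d)).val).trace = ((∑ k ∈ Finset.range m,
        (1 - (Module.finrank ℂ (localSpan ψ k) : ℝ) / (Fintype.card d : ℝ) ^ n) : ℝ) : ℂ) := by
      have hN' : (Fintype.card d : ℂ) ≠ 0 := by exact_mod_cast Fintype.card_ne_zero (α := d)
      simp only [maximallyMixed, hH, Matrix.mul_smul, Matrix.mul_one, Matrix.trace_smul,
        Matrix.trace_sum, Matrix.trace_sub, Matrix.trace_one, (hP _).trace_eq, smul_eq_mul,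
        Fintype.card_fun, Fintype.card_fin]
      push_cast
      rw [Finset.mul_sum]
      refine Finset.sum_congr rfl fun k _ => ?_
      field_simp
    rw [h1, Complex.ofReal_re]
    calc (m / 2 : ℝ) = ∑ _k ∈ Finset.range m, (1 / 2 : ℝ) := by simp; ring
      _ ≤ _ := Finset.sum_le_sum fun k hk => by
        have hkm : 24 * k ≤ n := by have := Finset.mem_range.mp hk; omega
        have := two_mul_finrank_localSpan_le ψ hkm hn
        have h2 : 2 * (Module.finrank ℂ (localSpan ψ k) : ℝ) ≤ (Fintype.card d : ℝ) ^ n := by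
          exact_mod_cast this
        have h3 : (Module.finrank ℂ (localSpan ψ k) : ℝ) / (Fintype.card d : ℝ) ^ n ≤ 1 / 2 := by
          rw [div_le_iff₀ hN]
          linarith
        linarith
  have hlip : ∀ (i : Fin n) (τ η : DensityMatrix (Fin n → d)),
      traceOut i τ.val = traceOut i η.val → -1 ≤ (H * (τ.val - η.val)).trace.re := by
    intro i τ η h
    -- `S` commutes with the algebra of site `i`, so it cannot distinguish `τ` from `η`, and `H` may
    -- be replaced by `H - S`.
    set S := ∑ k ∈ Finset.range m, (1 - R i k) with hS
    have hS0 : (S * (τ.val - η.val)).trace = 0 := by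
      rw [hS, Finset.sum_mul, Matrix.trace_sum]
      refine Finset.sum_eq_zero fun k _ => ?_
      refine trace_mul_eq_zero_of_commute (fun p q => ?_) (traceOut_sub_eq_zero h)
      rw [Matrix.sub_mul, Matrix.mul_sub, Matrix.one_mul, Matrix.mul_one,
        (hR i k).commute (siteUnit_mulVec_mem ψ i k p q)]
      rw [conjTranspose_siteUnit]
      exact siteUnit_mulVec_mem ψ i k q p
    have hd : H - S = ∑ k ∈ Finset.range m, (R i k - P k) := by
      rw [hH, hS, ← Finset.sum_sub_distrib]
      exact Finset.sum_congr rfl fun k _ => by abel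
    have h1 : (H - S - 0).PosSemidef := by
      rw [hd, sub_zero]
      exact Matrix.posSemidef_sum _ fun k _ => (hP k).posSemidef_sub (hR i k) (localSpan_le ψ i k)
    have h2 : (1 - (H - S)).PosSemidef := by
      -- The inclusions `P k ≤ R i k ≤ P (k + 1)` interlace, so `∑ (R i k - P k)` is dominated by
      -- the telescoping sum `P m - P 0 ≤ 1`.
      have e : 1 - (H - S) = (1 - P m) + (P 0 - 0) + ∑ k ∈ Finset.range m, (P (k + 1) - R i k) := by
        have : ∑ k ∈ Finset.range m, (P (k + 1) - P k) = P m - P 0 := Finset.sum_range_sub P m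
        have h3 : ∑ k ∈ Finset.range m, (P (k + 1) - R i k) =
            ∑ k ∈ Finset.range m, (P (k + 1) - P k) - ∑ k ∈ Finset.range m, (R i k - P k) := by
          rw [← Finset.sum_sub_distrib]
          exact Finset.sum_congr rfl fun k _ => by abel
        rw [h3, this, hd]
        abel
      rw [e]
      refine (((hP m).posSemidef_sub .top le_top).add
        (IsOrthProj.bot.posSemidef_sub (hP 0) bot_le)).add ?_
      exact Matrix.posSemidef_sum _ fun k _ =>
        (hR i k).posSemidef_sub (hP (k + 1)) (localSpanInsert_le ψ i k)
    have h3 := trace_mul_re_le h1 τ.posSemidef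
    have h4 := trace_mul_re_le h2 η.posSemidef
    have h5 : (H * (τ.val - η.val)).trace.re =
        ((H - S) * τ.val).trace.re - ((H - S) * η.val).trace.re := by
      rw [← Complex.sub_re, ← Matrix.trace_sub, ← Matrix.mul_sub, Matrix.sub_mul H S,
        Matrix.trace_sub, hS0, sub_zero]
    simp only [Matrix.zero_mul, Matrix.one_mul, Matrix.trace_zero, η.trace_eq_one,
      Complex.zero_re, Complex.one_re] at h3 h4
    rw [h5]
    linarith
  refine le_sInf ?_
  rintro w ⟨c, τ, η, h1, h2, rfl⟩
  have h3 : (H * (ρ.val - (maximallyMixed (Fin n → d)).val)).trace.re =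
      ∑ i, (c i : ℝ) * (H * ((τ i).val - (η i).val)).trace.re := by
    rw [h2, Finset.mul_sum, Matrix.trace_sum, Complex.re_sum]
    refine Finset.sum_congr rfl fun i _ => ?_
    rw [Matrix.mul_smul, Matrix.trace_smul, smul_eq_mul, Complex.re_ofReal_mul]
  have h4 : -∑ i, (c i : ℝ) ≤ ∑ i, (c i : ℝ) * (H * ((τ i).val - (η i).val)).trace.re := by
    rw [← Finset.sum_neg_distrib]
    refine Finset.sum_le_sum fun i _ => ?_
    have := mul_le_mul_of_nonneg_left (hlip i (τ i) (η i) (h1 i)) (c i).2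
    simpa using this
  rw [Matrix.mul_sub, Matrix.trace_sub, hHρ, zero_sub, Complex.neg_re] at h3
  rw [← ENNReal.ofReal_coe_nnreal]
  refine ENNReal.ofReal_le_ofReal ?_
  push_cast
  linarith

theorem not_isWassersteinAlmostIID_of_isPure [Nontrivial d] {Ψ : Source d}
    (hΨ : ∀ n, (Ψ n).IsPure) : ¬ IsWassersteinAlmostIID Ψ (maximallyMixed d) := by
  intro h
  have h1 : ∀ᶠ n : ℕ in atTop, ENNReal.ofReal (1 / 96) ≤
      wassersteinDist (Ψ n) (tensorPower (Fin n) (maximallyMixed d)) / n := by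
    filter_upwards [eventually_ge_atTop 24] with n hn
    have hn0 : (n : ℝ≥0∞) ≠ 0 := by exact_mod_cast (by omega : n ≠ 0)
    rw [ENNReal.le_div_iff_mul_le (Or.inl hn0) (Or.inl (ENNReal.natCast_ne_top n)),
      tensorPower_maximallyMixed]
    -- Take `m = n / 24`, rounded down; for `n ≥ 24` rounding loses at most a factor 2, whence `1 /
    -- 96`.
    refine le_trans ?_ (half_le_wassersteinDist (hΨ n) (Nat.mul_div_le n 24) (by omega))
    rw [← ENNReal.ofReal_natCast, ← ENNReal.ofReal_mul (by norm_num)]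
    refine ENNReal.ofReal_le_ofReal ?_
    have h2 : n ≤ 48 * (n / 24) := by omega
    have h3 : (n : ℝ) ≤ 48 * ((n / 24 : ℕ) : ℝ) := by exact_mod_cast h2
    linarith
  have h2 := ge_of_tendsto h h1
  simp at h2

end PureSources

/-! ### Gilbert–Varshamov counting for symmetric matrices over the field with two elements. -/

section GraphCounting

variable {n : ℕ}

/-- The symmetric bilinear action on `u` of the matrix with off-diagonal entries
`G i j + G j i` and diagonal entries `G i i`. -/
def symAction (u : Fin n → ZMod 2) : (Fin n → Fin n → ZMod 2) →+ (Fin n → ZMod 2) where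
  toFun G := fun j => ∑ i, (if i = j then G j j else G i j + G j i) * u i
  map_zero' := by ext j; simp
  map_add' G G' := by
    ext j
    simp only [Pi.add_apply, ← Finset.sum_add_distrib]
    refine Finset.sum_congr rfl fun i _ => ?_
    split_ifs <;> ring

theorem symAction_apply (u : Fin n → ZMod 2) (G : Fin n → Fin n → ZMod 2) (j : Fin n) :
    symAction u G j = ∑ i, (if i = j then G j j else G i j + G j i) * u i := rfl

theorem symAction_surjective {u : Fin n → ZMod 2} (hu : u ≠ 0) :
    Function.Surjective (symAction u) := by
  intro v
  obtain ⟨k, hk⟩ := Function.ne_iff.mp hu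
  have hk1 : u k = 1 := by
    have : ∀ a : ZMod 2, a ≠ 0 → a = 1 := by decide
    exact this _ hk
  set t := ∑ j ∈ Finset.univ.erase k, v j * u j with ht
  -- Only row `k` is nonzero, where `u k = 1`. Its off-diagonal entries produce `v` away from `k`;
  -- the diagonal entry adds `t` to cancel their contribution at `k`.
  refine ⟨fun i j => if i = k then (if j = k then v k + t else v j) else 0, ?_⟩
  ext j
  rw [symAction_apply]
  by_cases hj : j = k
  · subst hj
    rw [← Finset.add_sum_erase _ _ (Finset.mem_univ j)]
    have : ∑ x ∈ Finset.univ.erase j, (if x = j then (if j = j then (if j = j then v j + t else v j)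
        else 0) else (if x = j then (if j = j then v j + t else v j) else 0) +
          (if j = j then (if x = j then v j + t else v x) else 0)) * u x = t := by
      rw [ht]
      refine Finset.sum_congr rfl fun x hx => ?_
      simp [Finset.ne_of_mem_erase hx]
    rw [this]
    simp [hk1, add_assoc, CharTwo.add_self_eq_zero]
  · rw [Finset.sum_eq_single k]
    · simp [hj, hk1, Ne.symm hj]
    · intro i _ hi
      simp [hi, hj]
    · simp

theorem card_fiber_symAction {u : Fin n → ZMod 2} (hu : u ≠ 0) (v : Fin n → ZMod 2) :
    (Finset.univ.filter fun G => symAction u G = v).card * 2 ^ n =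
      Fintype.card (Fin n → Fin n → ZMod 2) := by
  have h : ∀ w : Fin n → ZMod 2, (Finset.univ.filter fun G => symAction u G = w).card =
      (Finset.univ.filter fun G => symAction u G = v).card := fun w =>
    AddMonoidHom.card_fiber_eq_of_mem_range (symAction u)
      (symAction_surjective hu w) (symAction_surjective hu v)
  rw [← Finset.card_univ, Finset.card_eq_sum_card_fiberwise (f := symAction u)
    (s := (Finset.univ : Finset (Fin n → Fin n → ZMod 2))) (t := Finset.univ)
    (fun _ _ => by simp), Finset.sum_congr rfl fun w _ => h w, Finset.sum_const, smul_eq_mul,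
    mul_comm, Finset.card_univ, Fintype.card_fun, ZMod.card, Fintype.card_fin]

/-- The number of sites at which a pair of bit strings is nonzero. -/
def pairWeight (p : Fin n → ZMod 2 × ZMod 2) : ℕ := (Finset.univ.filter fun j => p j ≠ 0).card

theorem sum_pow_pairWeight (a : ℝ) :
    ∑ p : Fin n → ZMod 2 × ZMod 2, a ^ pairWeight p = (1 + 3 * a) ^ n := by
  have h : ∀ p : Fin n → ZMod 2 × ZMod 2, a ^ pairWeight p = ∏ j, if p j ≠ 0 then a else 1 :=
    fun p => by rw [pairWeight, Finset.prod_ite]; simp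
  have h1 : ∑ b : ZMod 2 × ZMod 2, (if b ≠ 0 then a else 1) = 1 + 3 * a := by
    rw [Fintype.sum_prod_type]
    change ∑ x : Fin 2, ∑ y : Fin 2, (if ((x, y) : Fin 2 × Fin 2) ≠ 0 then a else 1) = _
    simp [Fin.sum_univ_two]
    ring
  rw [Finset.sum_congr rfl fun p _ => h p, ← Fintype.piFinset_univ,
    ← Finset.prod_univ_sum (fun _ : Fin n => Finset.univ)
      (fun _ (b : ZMod 2 × ZMod 2) => if b ≠ 0 then a else 1),
    Finset.prod_congr rfl fun _ _ => h1]
  simp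

-- This is the Chernoff bound behind 0.189: `7 / 90` is close to the optimal weight `a` solving `3 a
-- / (1 + 3 a) = 0.189`, and `37 / 30 = 1 + 3 a`.
set_option exponentiation.threshold 2000 in
theorem pow_thousand_le : (37 / 30 : ℝ) ^ 1000 ≤ 2 ^ 1000 * (7 / 90) ^ 189 := by
  norm_num

theorem card_pairWeight_le {w : ℕ} (hw : 1000 * w ≤ 189 * n) :
    (Finset.univ.filter fun p : Fin n → ZMod 2 × ZMod 2 => pairWeight p ≤ w).card ≤ 2 ^ n := by
  set S := Finset.univ.filter fun p : Fin n → ZMod 2 × ZMod 2 => pairWeight p ≤ w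
  have h1 : (S.card : ℝ) * (7 / 90) ^ w ≤ (37 / 30) ^ n := by
    calc (S.card : ℝ) * (7 / 90) ^ w = ∑ _p ∈ S, (7 / 90 : ℝ) ^ w := by simp
      _ ≤ ∑ p ∈ S, (7 / 90 : ℝ) ^ pairWeight p := Finset.sum_le_sum fun p hp =>
          pow_le_pow_of_le_one (by norm_num) (by norm_num) (Finset.mem_filter.mp hp).2
      _ ≤ ∑ p, (7 / 90 : ℝ) ^ pairWeight p :=
          Finset.sum_le_sum_of_subset_of_nonneg (Finset.subset_univ _) fun _ _ _ => by positivity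
      _ = (37 / 30) ^ n := by rw [sum_pow_pairWeight]; norm_num
  have h2 : (37 / 30 : ℝ) ^ n ≤ 2 ^ n * (7 / 90) ^ w := by
    refine le_of_pow_le_pow_left₀ (n := 1000) (by norm_num) (by positivity) ?_
    calc ((37 / 30 : ℝ) ^ n) ^ 1000 = ((37 / 30) ^ 1000) ^ n := by rw [← pow_mul, ← pow_mul, mul_comm]
      _ ≤ (2 ^ 1000 * (7 / 90) ^ 189) ^ n := pow_le_pow_left₀ (by positivity) pow_thousand_le n
      _ = 2 ^ (1000 * n) * (7 / 90) ^ (189 * n) := by rw [mul_pow, ← pow_mul, ← pow_mul]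
      _ ≤ 2 ^ (1000 * n) * (7 / 90) ^ (1000 * w) := by
          refine mul_le_mul_of_nonneg_left ?_ (by positivity)
          exact pow_le_pow_of_le_one (by norm_num) (by norm_num) hw
      _ = (2 ^ n * (7 / 90) ^ w) ^ 1000 := by
          rw [mul_pow, ← pow_mul, ← pow_mul, mul_comm n, mul_comm w]
  have h3 : (S.card : ℝ) ≤ 2 ^ n :=
    le_of_mul_le_mul_right (h1.trans h2) (by positivity)
  exact_mod_cast h3

/-- A Gilbert–Varshamov argument: some symmetric action maps no nonzero vector supported on
a set of at most `w` sites to a vector supported on the same set. -/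
theorem exists_symAction_expanding {w : ℕ} (hw : 1000 * w ≤ 189 * n) :
    ∃ G : Fin n → Fin n → ZMod 2, ∀ (I : Finset (Fin n)) (u : Fin n → ZMod 2), I.card ≤ w → u ≠ 0 →
      (∀ j ∉ I, u j = 0) → ∃ j ∉ I, symAction u G j ≠ 0 := by
  by_contra! hcon
  set S := Finset.univ.filter fun p : Fin n → ZMod 2 × ZMod 2 => pairWeight p ≤ w with hS
  have h0 : (0 : Fin n → ZMod 2 × ZMod 2) ∈ S := by simp [hS, pairWeight]
  let T := S.filter fun p => (fun j => (p j).1) ≠ 0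
  -- Dropping the zero pair makes the bound strict. Each remaining pair is realised by a fraction `2
  -- ^ (-n)` of the `G`, so the bad `G` cannot exhaust all of them.
  have hT : T.card < 2 ^ n := by
    refine lt_of_lt_of_le (Finset.card_lt_card ?_) (card_pairWeight_le hw)
    refine Finset.filter_ssubset.mpr ⟨0, h0, ?_⟩
    simp only [ne_eq, not_not]
    rfl
  have hcover : (Finset.univ : Finset (Fin n → Fin n → ZMod 2)) ⊆ T.biUnion fun p =>
      Finset.univ.filter fun G => symAction (fun j => (p j).1) G = fun j => (p j).2 := by
    intro G _
    obtain ⟨I, u, hI, hu, hsupp, hv⟩ := hcon G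
    refine Finset.mem_biUnion.mpr ⟨fun j => (u j, symAction u G j), ?_, by simp⟩
    refine Finset.mem_filter.mpr ⟨Finset.mem_filter.mpr ⟨Finset.mem_univ _, ?_⟩, hu⟩
    refine (Finset.card_le_card fun j hj => ?_).trans hI
    by_contra hjI
    exact (Finset.mem_filter.mp hj).2 (Prod.ext (hsupp j hjI) (hv j hjI))
  have h1 := (Finset.card_le_card hcover).trans Finset.card_biUnion_le
  have h2 : Fintype.card (Fin n → Fin n → ZMod 2) * 2 ^ n ≤
      T.card * Fintype.card (Fin n → Fin n → ZMod 2) := by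
    calc _ ≤ _ := Nat.mul_le_mul_right (2 ^ n) h1
      _ = ∑ p ∈ T, Fintype.card (Fin n → Fin n → ZMod 2) := by
        rw [Finset.sum_mul]
        exact Finset.sum_congr rfl fun p hp =>
          card_fiber_symAction (Finset.mem_filter.mp hp).2 _
      _ = _ := by rw [Finset.sum_const, smul_eq_mul]
  have h3 : 0 < Fintype.card (Fin n → Fin n → ZMod 2) := Fintype.card_pos
  rw [mul_comm] at h2
  exact absurd (le_of_mul_le_mul_right h2 h3) (not_le.mpr hT)

end GraphCounting

/-! ### Graph states and their marginals. -/

section GraphStates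

variable {n : ℕ}

/-- The bit `a` as an element of the field with two elements. -/
def bit (a : Fin 2) : ZMod 2 := (a.val : ZMod 2)

theorem bit_injective : Function.Injective bit := by decide

/-- The nontrivial additive character of the field with two elements. -/
def sgn (a : ZMod 2) : ℂ := if a = 0 then 1 else -1

theorem sgn_add (a b : ZMod 2) : sgn (a + b) = sgn a * sgn b := by
  have : ∀ a b : ZMod 2, a + b = 0 ↔ (a = 0 ↔ b = 0) := by decide
  simp only [sgn, this]
  by_cases ha : a = 0 <;> by_cases hb : b = 0 <;> simp [ha, hb]

theorem star_sgn (a : ZMod 2) : star (sgn a) = sgn a := by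
  unfold sgn; split_ifs <;> simp

theorem norm_sgn (a : ZMod 2) : ‖sgn a‖ = 1 := by
  unfold sgn; split_ifs <;> simp

/-- The quadratic form over the field with two elements with coefficients `G`. -/
def quadForm (G : Fin n → Fin n → ZMod 2) (x : Fin n → ZMod 2) : ZMod 2 :=
  ∑ i, ∑ j, G i j * x i * x j

/-- Polarisation in characteristic two. -/
theorem quadForm_add (G : Fin n → Fin n → ZMod 2) (u y : Fin n → ZMod 2) :
    quadForm G (y + u) + quadForm G y =
      quadForm G u + ∑ j, y j * ∑ i, (G i j + G j i) * u i := by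
  have h : ∑ j, y j * ∑ i, (G i j + G j i) * u i =
      ∑ i, ∑ j, (G i j * u i * y j + G i j * y i * u j) := by
    simp only [Finset.mul_sum, Finset.sum_add_distrib]
    rw [Finset.sum_comm (f := fun i j => G i j * u i * y j)]
    simp only [← Finset.sum_add_distrib]
    refine Finset.sum_congr rfl fun j _ => Finset.sum_congr rfl fun i _ => by ring
  rw [h]
  simp only [quadForm, ← Finset.sum_add_distrib, Pi.add_apply]
  refine Finset.sum_congr rfl fun i _ => Finset.sum_congr rfl fun j _ => ?_
  linear_combination CharTwo.add_self_eq_zero (G i j * y i * y j)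

/-- The amplitudes of the (weighted) graph state of `G`. -/
noncomputable def graphVector (G : Fin n → Fin n → ZMod 2) (x : Fin n → Fin 2) : ℂ :=
  ((Real.sqrt (2 ^ n))⁻¹ : ℝ) * sgn (quadForm G fun i => bit (x i))

theorem sum_norm_sq_graphVector (G : Fin n → Fin n → ZMod 2) :
    ∑ x, ‖graphVector G x‖ ^ 2 = 1 := by
  have h : ∀ x, ‖graphVector G x‖ ^ 2 = (2 ^ n)⁻¹ := fun x => by
    rw [graphVector, norm_mul, norm_sgn, mul_one, Complex.norm_real, Real.norm_eq_abs, sq_abs,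
      inv_pow, Real.sq_sqrt (by positivity)]
  simp [h]

theorem graphVector_mul_star (G : Fin n → Fin n → ZMod 2) (x y : Fin n → Fin 2) :
    graphVector G x * star (graphVector G y) = (2 ^ n)⁻¹ *
      sgn ((quadForm G fun i => bit (x i)) + quadForm G fun i => bit (y i)) := by
  have h : (((Real.sqrt (2 ^ n))⁻¹ : ℝ) : ℂ) * ((Real.sqrt (2 ^ n))⁻¹ : ℝ) = (2 ^ n)⁻¹ := by
    rw [← Complex.ofReal_mul, ← mul_inv, Real.mul_self_sqrt (by positivity)]
    push_cast
    rfl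
  rw [graphVector, graphVector, star_mul', star_sgn, sgn_add, ← h]
  simp only [Complex.star_def, Complex.conj_ofReal]
  ring

theorem trace_vecMulVec_star {ι : Type*} [Fintype ι] {ψ : ι → ℂ} (hψ : ∑ x, ‖ψ x‖ ^ 2 = 1) :
    (Matrix.vecMulVec ψ (star ψ)).trace = 1 := by
  simp only [Matrix.trace, Matrix.diag_apply, Matrix.vecMulVec_apply, Pi.star_apply,
    Complex.star_def, Complex.mul_conj, Complex.normSq_eq_norm_sq]
  exact_mod_cast hψ

/-- The rank-one projection onto a unit vector. -/
def pureState {ι : Type*} [Fintype ι] (ψ : ι → ℂ) (hψ : ∑ x, ‖ψ x‖ ^ 2 = 1) : DensityMatrix ι :=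
  ⟨Matrix.vecMulVec ψ (star ψ), Matrix.posSemidef_vecMulVec_self_star ψ, trace_vecMulVec_star hψ⟩

/-- By polarisation with `u = a + b`, the entry at `(a, b)` is, up to a scalar, the sum over `z` of
a character with exponent `v = (G + Gᵀ) u`. It vanishes once `v` is nonzero at a traced-out site. -/
theorem marginal_graphState {G : Fin n → Fin n → ZMod 2} {I : Finset (Fin n)}
    (hG : ∀ u : Fin n → ZMod 2, u ≠ 0 → (∀ j ∉ I, u j = 0) → ∃ j ∉ I, symAction u G j ≠ 0) :
    marginal I (pureState (graphVector G) (sum_norm_sq_graphVector G)).val =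
      (maximallyMixed ({j // j ∈ I} → Fin 2)).val := by
  ext a b
  simp only [marginal, pureState, Matrix.of_apply, Matrix.vecMulVec_apply, Pi.star_apply,
    graphVector_mul_star]
  rw [← Finset.mul_sum]
  by_cases hab : a = b
  · subst hab
    have hc : (Fintype.card ({j // j ∉ I} → Fin 2) : ℂ) * Fintype.card ({j // j ∈ I} → Fin 2) =
        2 ^ n := by
      have h := Fintype.card_congr (Equiv.piEquivPiSubtypeProd (· ∈ I) fun _ => Fin 2)
      rw [Fintype.card_prod, Fintype.card_fun, Fintype.card_fin, Fintype.card_fin] at h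
      rw [mul_comm]
      exact_mod_cast h.symm
    have h0 : (Fintype.card ({j // j ∈ I} → Fin 2) : ℂ) ≠ 0 := by
      exact_mod_cast Fintype.card_ne_zero
    simp only [CharTwo.add_self_eq_zero, maximallyMixed, Matrix.smul_apply, Matrix.one_apply_eq,
      smul_eq_mul, mul_one]
    rw [← hc]
    have h1 : (Fintype.card ({j // j ∉ I} → Fin 2) : ℂ) ≠ 0 := by
      exact_mod_cast Fintype.card_ne_zero
    rw [show sgn 0 = 1 from if_pos rfl, Finset.sum_const, Finset.card_univ, nsmul_eq_mul, mul_one]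
    field_simp
  · have hrhs : (maximallyMixed ({j // j ∈ I} → Fin 2)).val a b = 0 := by
      simp [maximallyMixed, hab]
    rw [hrhs]
    set u : Fin n → ZMod 2 := fun j =>
      if h : j ∈ I then bit (a ⟨j, h⟩) + bit (b ⟨j, h⟩) else 0 with hu
    have hu0 : u ≠ 0 := by
      obtain ⟨j, hj⟩ := Function.ne_iff.mp hab
      intro h
      have h1 := congrFun h j
      simp only [hu, j.2, dite_true, Pi.zero_apply] at h1
      exact hj (bit_injective (CharTwo.add_eq_zero.mp h1))
    have huI : ∀ j ∉ I, u j = 0 := fun j hj => by simp [hu, hj]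
    obtain ⟨j₀, hj₀, hv⟩ := hG u hu0 huI
    set v : Fin n → ZMod 2 := fun j => ∑ i, (G i j + G j i) * u i with hvdef
    have hv1 : v j₀ = 1 := by
      have h1 : ∀ t : ZMod 2, t ≠ 0 → t = 1 := by decide
      refine h1 _ ?_
      -- The diagonal entries of `symAction` differ from those of `G + Gᵀ`, harmlessly since `u j₀ =
      -- 0`.
      convert hv using 1
      rw [symAction_apply]
      refine Finset.sum_congr rfl fun i _ => ?_
      split_ifs with h
      · rw [h, huI j₀ hj₀, mul_zero, mul_zero]
      · rfl
    have hsum : ∀ z, (quadForm G fun i => bit (glue I a z i)) +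
        (quadForm G fun i => bit (glue I b z i)) =
          quadForm G u + ∑ j, bit (glue I b z j) * v j := fun z => by
      rw [← quadForm_add]
      congr 2
      ext i
      by_cases hi : i ∈ I
      · simp only [glue, hu, hi, dite_true, Pi.add_apply]
        linear_combination -CharTwo.add_self_eq_zero (bit (b ⟨i, hi⟩))
      · simp [glue, hu, hi]
    simp only [hsum]
    refine mul_eq_zero_of_right _ ?_
    refine sum_eq_zero_of_sum_update (⟨j₀, hj₀⟩ : {j // j ∉ I}) _ fun z => ?_
    have hupd : ∀ c : Fin 2, ∑ j, bit (glue I b (Function.update z ⟨j₀, hj₀⟩ c) j) * v j =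
        bit c + ∑ j ∈ Finset.univ.erase j₀, bit (glue I b z j) * v j := fun c => by
      rw [← Finset.add_sum_erase _ _ (Finset.mem_univ j₀)]
      congr 1
      · simp [glue, hj₀, hv1]
      · refine Finset.sum_congr rfl fun j hj => ?_
        have := Finset.ne_of_mem_erase hj
        by_cases hjI : j ∈ I <;> simp [glue, hjI, this]
    rw [Fin.sum_univ_two, hupd, hupd]
    simp only [sgn_add]
    have : sgn (bit 0) + sgn (bit 1) = 0 := by simp [sgn, bit]
    linear_combination (sgn (quadForm G u) *
      sgn (∑ j ∈ Finset.univ.erase j₀, bit (glue I b z j) * v j)) * this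

theorem exists_isHighlyUniform : ∃ Ψ : Source (Fin 2), IsHighlyUniform Ψ := by
  choose G hG using fun n => exists_symAction_expanding (n := n) (w := 189 * n / 1000)
    (Nat.mul_div_le _ _)
  refine ⟨fun n => pureState (graphVector (G n)) (sum_norm_sq_graphVector _),
    fun n => ⟨_, sum_norm_sq_graphVector _, rfl⟩, Eventually.of_forall fun n I hI => ?_⟩
  refine marginal_graphState fun u hu hsupp => hG n I u ?_ hu hsupp
  rw [Nat.le_div_iff_mul_le (by norm_num)]
  have : (I.card : ℝ) * 1000 ≤ 189 * n := by linarith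
  exact_mod_cast this

end GraphStates

/-! ### Highly uniform sources are weakly almost i.i.d. along exactly one state. -/

section HighlyUniform

theorem IsHighlyUniform.isWeaklyAlmostIID {Ψ : Source (Fin 2)} (hΨ : IsHighlyUniform Ψ) :
    IsWeaklyAlmostIID Ψ (maximallyMixed (Fin 2)) := by
  intro k _
  refine tendsto_const_nhds.congr' ?_
  -- Since `1 / 6 < 0.189`, subsets of size `k` are small enough once `6 k ≤ n`.
  filter_upwards [hΨ.2, eventually_ge_atTop (6 * k)] with n hn hk
  rw [Finset.sum_eq_zero, mul_zero]
  intro I hI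
  have hIk := (Finset.mem_powersetCard.mp hI).2
  have h6 : (6 * k : ℝ) ≤ n := by exact_mod_cast hk
  rw [hn I (by rw [hIk]; linarith), tensorPower_maximallyMixed, sub_self, traceNorm_zero]

/-- The state along which a highly uniform source is weakly almost i.i.d. is unique. -/
theorem IsHighlyUniform.eq_maximallyMixed {Ψ : Source (Fin 2)} (hΨ : IsHighlyUniform Ψ)
    {ρ : DensityMatrix (Fin 2)} (h : IsWeaklyAlmostIID Ψ ρ) : ρ = maximallyMixed (Fin 2) := by
  set μ := maximallyMixed (Fin 2) with hμ
  -- The Hilbert–Schmidt distance from `ρ` to `μ` bounds every one-site term from below, uniformly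
  -- in `n`, so the case `k = 1` forces it to vanish.
  set s : ℝ := Real.sqrt (∑ x, ∑ y, ‖μ.val x y - ρ.val x y‖ ^ 2) with hs
  have hterm : ∀ {n : ℕ} (i : Fin n), s ≤ traceNorm
      ((tensorPower {j // j ∈ ({i} : Finset (Fin n))} μ).val -
        (tensorPower {j // j ∈ ({i} : Finset (Fin n))} ρ).val) := by
    intro n i
    refine Real.sqrt_le_iff.mpr ⟨traceNorm_nonneg _, le_trans (le_of_eq ?_)
      (sum_norm_sq_le_traceNorm_sq _)⟩
    let e := (Equiv.funUnique {j // j ∈ ({i} : Finset (Fin n))} (Fin 2)).symm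
    rw [← e.sum_comp]
    refine Finset.sum_congr rfl fun x _ => ?_
    rw [← e.sum_comp]
    refine Finset.sum_congr rfl fun y _ => ?_
    simp [tensorPower, tensorPowerMatrix, e]
  have hle : ∀ᶠ n : ℕ in atTop, s ≤ ((n.choose 1 : ℝ))⁻¹ *
      ∑ I ∈ Finset.powersetCard 1 (Finset.univ : Finset (Fin n)),
        traceNorm (marginal I (Ψ n).val - (tensorPower {j // j ∈ I} ρ).val) := by
    filter_upwards [hΨ.2, eventually_ge_atTop 6] with n hn h6
    have h6' : (6 : ℝ) ≤ n := by exact_mod_cast h6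
    have hpos : (0 : ℝ) < (n.choose 1 : ℕ) := by rw [Nat.choose_one_right]; linarith
    rw [le_inv_mul_iff₀ hpos]
    have : ((n.choose 1 : ℕ) : ℝ) * s =
        ∑ _I ∈ Finset.powersetCard 1 (Finset.univ : Finset (Fin n)), s := by simp
    rw [this]
    refine Finset.sum_le_sum fun I hI => ?_
    have hI1 := (Finset.mem_powersetCard.mp hI).2
    rw [hn I (by rw [hI1]; push_cast; linarith), ← tensorPower_maximallyMixed]
    obtain ⟨i, rfl⟩ := Finset.card_eq_one.mp hI1
    exact hterm i
  have hs0 : s ≤ 0 := ge_of_tendsto (h 1 le_rfl) hle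
  have h0 : ∑ x, ∑ y, ‖μ.val x y - ρ.val x y‖ ^ 2 = 0 :=
    (Real.sqrt_eq_zero (by positivity)).mp (le_antisymm hs0 (Real.sqrt_nonneg _))
  have hval : ρ.val = μ.val := by
    ext x y
    have h1 := (Finset.sum_eq_zero_iff_of_nonneg fun x _ => by positivity).mp h0 x
      (Finset.mem_univ x)
    have h2 := (Finset.sum_eq_zero_iff_of_nonneg fun y _ => by positivity).mp h1 y
      (Finset.mem_univ y)
    exact (sub_eq_zero.mp (by simpa using h2)).symm
  cases ρ
  simpa [hμ, maximallyMixed] using hval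

end HighlyUniform

end AlmostIID

theorem mainTheorem7 :
    -- no source of pure states is Wasserstein almost i.i.d. along the maximally mixed state
    (∀ (d : Type) [Fintype d] [DecidableEq d] [Nontrivial d] (Ψ : AlmostIID.Source d),
      (∀ n, (Ψ n).IsPure) →
        ¬ AlmostIID.IsWassersteinAlmostIID Ψ (AlmostIID.maximallyMixed d)) ∧
    -- highly uniform sources exist, and are weakly but not Wasserstein almost i.i.d.
    (∃ Ψ : AlmostIID.Source (Fin 2), AlmostIID.IsHighlyUniform Ψ) ∧
    (∀ Ψ : AlmostIID.Source (Fin 2), AlmostIID.IsHighlyUniform Ψ →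
      ¬ AlmostIID.IsWassersteinAlmostIID Ψ (AlmostIID.maximallyMixed (Fin 2)) ∧
      AlmostIID.IsWeaklyAlmostIID Ψ (AlmostIID.maximallyMixed (Fin 2))) ∧
    -- Wasserstein almost i.i.d. sources are weakly almost i.i.d.
    (∀ (d : Type) [Fintype d] [DecidableEq d] (ρn : AlmostIID.Source d)
      (ρ : AlmostIID.DensityMatrix d),
      AlmostIID.IsWassersteinAlmostIID ρn ρ → AlmostIID.IsWeaklyAlmostIID ρn ρ) ∧
    -- the inclusion is strict, both along the maximally mixed state and for the whole classes
    ({ρn : AlmostIID.Source (Fin 2) |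
        AlmostIID.IsWassersteinAlmostIID ρn (AlmostIID.maximallyMixed (Fin 2))} ⊂
      {ρn : AlmostIID.Source (Fin 2) |
        AlmostIID.IsWeaklyAlmostIID ρn (AlmostIID.maximallyMixed (Fin 2))}) ∧
    ({ρn : AlmostIID.Source (Fin 2) | ∃ ρ, AlmostIID.IsWassersteinAlmostIID ρn ρ} ⊂
      {ρn : AlmostIID.Source (Fin 2) | ∃ ρ, AlmostIID.IsWeaklyAlmostIID ρn ρ}) := by
  obtain ⟨Ψ, hΨ⟩ := AlmostIID.exists_isHighlyUniform
  have hnot := AlmostIID.not_isWassersteinAlmostIID_of_isPure hΨ.1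
  refine ⟨fun d _ _ _ Ψ hΨ => AlmostIID.not_isWassersteinAlmostIID_of_isPure hΨ, ⟨Ψ, hΨ⟩,
    fun Ψ hΨ => ⟨AlmostIID.not_isWassersteinAlmostIID_of_isPure hΨ.1, hΨ.isWeaklyAlmostIID⟩,
    fun d _ _ ρn ρ h => AlmostIID.isWeaklyAlmostIID_of_isWassersteinAlmostIID h, ?_, ?_⟩
  · refine (Set.ssubset_iff_of_subset fun ρn h =>
      AlmostIID.isWeaklyAlmostIID_of_isWassersteinAlmostIID h).mpr ⟨Ψ, hΨ.isWeaklyAlmostIID, hnot⟩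
  · refine (Set.ssubset_iff_of_subset ?_).mpr ⟨Ψ, ⟨_, hΨ.isWeaklyAlmostIID⟩, ?_⟩
    · rintro ρn ⟨ρ, h⟩
      exact ⟨ρ, AlmostIID.isWeaklyAlmostIID_of_isWassersteinAlmostIID h⟩
    · rintro ⟨ρ, h⟩
      rw [hΨ.eq_maximallyMixed (AlmostIID.isWeaklyAlmostIID_of_isWassersteinAlmostIID h)] at h
      exact hnot h
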